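/- Let $(\Omega,\mathcal A,\mathbb P)$ be a probability space with expectation $\mathbb E$, $E$ a real Banach space with closed dual unit ball $B_{E'}$, and $k\in\mathbb N=\{1,2,\dots\}$. Let $\otimes^{k,s}E$ be the linear span, inside the algebraic tensor product of $k$ copies of $E$, of all symmetrizations $\frac1{k!}\sum_{\sigma\in S_k}x_{\sigma(1)}\otimes\cdots\otimes x_{\sigma(k)}$ ($x_1,\dots,x_k\in E$), equipped with the symmetric injective tensor norm $\|U\|_{\varepsilon_s}=\sup_{f\in B_{E'}}|(f\otimes\cdots\otimes f)(U)|$, i.e. $\sup_{f\in B_{E'}}|\sum_j\lambda_jf(x_j)^k|$ if $U=\sum_j\lambda_j\,{\otimes^k}x_j$, where ${\otimes^k}x=x\otimes\cdots\otimes x$; let $\otimes^{k,s}_{\varepsilon_s}E$ be its completion. For $X\in L_k(\Omega;E)$ let $\mathbb M^k_\varepsilon[X]=\mathbb E[{\otimes^k}X]\in\otimes^{k,s}_{\varepsilon_s}E$ (Bochner integral) be its injective $k$th moment. For a Banach space $F$ and $r\in[1,\infty)$, $\|\eta\|_{L_r(\Omega;F)}=(\mathbb E\|\eta\|_F^r)^{1/r}$.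 Constants. A Rademacher family $(r_j)_{j\in\mathbb N}$ consists of independent random variables on a complete probability space $\widetilde\Omega$ that take the values $\pm1$ with probability $\frac12$ each. $E$ has (Rademacher) type $p\in[1,2]$ if there is a $\tau\in(0,\infty)$ such that $\|\sum_{j=1}^nr_jx_j\|_{L_p(\widetilde\Omega;E)}\le\tau(\sum_{j=1}^n\|x_j\|_E^p)^{1/p}$ for all Rademacher families, all $n$ and all $x_1,\dots,x_n\in E$; $\tau_p(E)$ is the infimum of such $\tau$. $K_{q,p}$ is the infimum of the $K\in(0,\infty)$ such that $\|\sum_{j=1}^nr_jx_j\|_{L_q(\widetilde\Omega;F)}\le K\|\sum_{j=1}^nr_jx_j\|_{L_p(\widetilde\Omega;F)}$ for all Rademacher families, all real Banach spaces $F$, all $n$ and all $x_1,\dots,x_n\in F$. $B_q$ is the infimum of the $B\in(0,\infty)$ such that $\|\sum_{j=1}^nr_ja_j\|_{L_q(\widetilde\Omega;\mathbb R)}\le B(\sum_{j=1}^na_j^2)^{1/2}$ for all Rademacher families, all $n$ and all $a_1,\dots,a_n\in\mathbb R$. Set $$C^{\rm diff}_{q,p,k}=16\,k\,\sqrt\pi\,K_{q,p}\,\tau_p(E)\,K_{q,2},\qquad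 C^{\rm ML}_{q,p,k}=2\max\{C^{\rm diff}_{q,p,k},B_q\}.$$ **Theorem.** Let $E$ be of Rademacher type $p\in[1,2]$, $q\in[p,\infty)$ and $k,L\in\mathbb N$. For every $\ell\in\{1,\dots,L\}$ let $X_\ell\in L_{kq}(\Omega;E)$ and $M_\ell\in\mathbb N$, and set $X_0:=0$. Then $\xi_\ell:={\otimes^k}X_\ell-{\otimes^k}X_{\ell-1}\in L_q(\Omega;\otimes^{k,s}_{\varepsilon_s}E)$ for every $\ell\in\{1,\dots,L\}$, and $\mathbb M^k_\varepsilon[X_L]$ exists. If, for every $\ell$, $\xi_{\ell,1},\dots,\xi_{\ell,M_\ell}$ are independent copies of $\xi_\ell$ on $\Omega$ (no independence between different levels is assumed), then for every $U\in\otimes^{k,s}_{\varepsilon_s}E$ the random variable $U-\sum_{\ell=1}^L\frac1{M_\ell}\sum_{j=1}^{M_\ell}\xi_{\ell,j}$ belongs to $L_q(\Omega;\otimes^{k,s}_{\varepsilon_s}E)$ and $$\Bigl\|U-\sum_{\ell=1}^L\frac1{M_\ell}\sum_{j=1}^{M_\ell}\xi_{\ell,j}\Bigr\|_{L_q(\Omega;\otimes^{k,s}_{\varepsilon_s}E)}\le\bigl\|U-\mathbb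 M^k_\varepsilon[X_L]\bigr\|_{\varepsilon_s}$$ $$+\,C^{\rm ML}_{q,p,k}\sum_{\ell=1}^L\Bigl[M_\ell^{-(1-\frac1p)}\|X_\ell-X_{\ell-1}\|_{L_{kq}(\Omega;E)}\sum_{i=0}^{k-1}\Bigl(\tbinom{k}{i+1}\|X_\ell-X_{\ell-1}\|_{L_{kq}(\Omega;E)}^i+\|X_\ell\|_{L_k(\Omega;E)}^i\Bigr)\|X_{\ell-1}\|_{L_{kq}(\Omega;E)}^{k-i-1}\Bigr],$$ with the convention $0^0=1$. -/

import Mathlib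

open MeasureTheory ProbabilityTheory
open scoped ENNReal TensorProduct Nat

universe u v

noncomputable section

/-! ### The `k`-fold symmetric injective tensor product -/

section SymmetricTensors

variable {E : Type u} [NormedAddCommGroup E] [NormedSpace ℝ E]

/-- The symmetrization `(1/k!) ∑_σ x_{σ(1)} ⊗ ⋯ ⊗ x_{σ(k)}` of `x_1 ⊗ ⋯ ⊗ x_k`. -/
def symmetrize (k : ℕ) (x : Fin k → E) : ⨂[ℝ] _ : Fin k, E :=
  ((k ! : ℕ) : ℝ)⁻¹ • ∑ σ : Equiv.Perm (Fin k), ⨂ₜ[ℝ] i : Fin k, x (σ i)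

variable (E) in
/-- The symmetric elements of the algebraic tensor product `E ⊗ ⋯ ⊗ E` (`k` factors):
the linear span of all symmetrizations. -/
def symTensorSubmodule (k : ℕ) : Submodule ℝ (⨂[ℝ] _ : Fin k, E) :=
  Submodule.span ℝ (Set.range (symmetrize (E := E) k))

variable (E) in
/-- The `k`-fold symmetric algebraic tensor product of `E`.  This is a type of its own, so that it
carries the symmetric injective tensor norm defined below and no other. -/
def SymTensor (k : ℕ) : Type u := symTensorSubmodule E k

namespace SymTensor

instance (k : ℕ) : AddCommGroup (SymTensor E k) :=
  inferInstanceAs (AddCommGroup (symTensorSubmodule E k))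

instance (k : ℕ) : Module ℝ (SymTensor E k) :=
  inferInstanceAs (Module ℝ (symTensorSubmodule E k))

variable (E) in
/-- The inclusion of the symmetric into the full algebraic tensor product. -/
def incl (k : ℕ) : SymTensor E k →ₗ[ℝ] ⨂[ℝ] _ : Fin k, E :=
  (symTensorSubmodule E k).subtype

/-- The linear functional `f ⊗ ⋯ ⊗ f` on the algebraic tensor product, with
`(f ⊗ ⋯ ⊗ f) (x_1 ⊗ ⋯ ⊗ x_k) = ∏ f (x_n)`. -/
def dualPow (k : ℕ) (f : StrongDual ℝ E) : (⨂[ℝ] _ : Fin k, E) →ₗ[ℝ] ℝ :=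
  PiTensorProduct.lift
    ((MultilinearMap.mkPiAlgebra ℝ (Fin k) ℝ).compLinearMap fun _ => f.toLinearMap)

@[simp]
theorem dualPow_tprod (k : ℕ) (f : StrongDual ℝ E) (x : Fin k → E) :
    dualPow k f (⨂ₜ[ℝ] i, x i) = ∏ i, f (x i) := by
  simp [dualPow]

theorem bddAbove_dualPow (k : ℕ) (U : ⨂[ℝ] _ : Fin k, E) :
    BddAbove (Set.range fun f : Metric.closedBall (0 : StrongDual ℝ E) 1 => |dualPow k f U|) := by
  induction U using PiTensorProduct.induction_on with
  | smul_tprod r x =>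
    refine ⟨|r| * ∏ i, ‖x i‖, ?_⟩
    rintro _ ⟨f, rfl⟩
    have hf : ‖(f : StrongDual ℝ E)‖ ≤ 1 := mem_closedBall_zero_iff.1 f.2
    simp only [map_smul, dualPow_tprod, smul_eq_mul, abs_mul, Finset.abs_prod]
    gcongr with i
    have h := (f : StrongDual ℝ E).le_of_opNorm_le hf (x i)
    simpa using h
  | add x y hx hy =>
    obtain ⟨a, ha⟩ := hx
    obtain ⟨b, hb⟩ := hy
    refine ⟨a + b, ?_⟩
    rintro _ ⟨f, rfl⟩
    simp only [map_add]
    exact (abs_add_le _ _).trans (add_le_add (ha ⟨f, rfl⟩) (hb ⟨f, rfl⟩))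

/-- The symmetric injective tensor norm: `‖U‖ = sup {|(f ⊗ ⋯ ⊗ f) U| : ‖f‖ ≤ 1}`. -/
instance (k : ℕ) : Norm (SymTensor E k) :=
  ⟨fun U => ⨆ f : Metric.closedBall (0 : StrongDual ℝ E) 1, |dualPow k f (incl E k U)|⟩

theorem norm_def (k : ℕ) (U : SymTensor E k) :
    ‖U‖ = ⨆ f : Metric.closedBall (0 : StrongDual ℝ E) 1, |dualPow k f (incl E k U)| := rfl

theorem core (k : ℕ) : SeminormedSpace.Core ℝ (SymTensor E k) where
  norm_nonneg U := Real.iSup_nonneg fun _ => abs_nonneg _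
  norm_smul c U := by
    simp only [norm_def, map_smul, smul_eq_mul, abs_mul, Real.norm_eq_abs]
    exact (Real.mul_iSup_of_nonneg (abs_nonneg c) _).symm
  norm_triangle U V := by
    have : Nonempty (Metric.closedBall (0 : StrongDual ℝ E) 1) := ⟨⟨0, by simp⟩⟩
    refine ciSup_le fun f => ?_
    rw [map_add, map_add]
    exact (abs_add_le _ _).trans (add_le_add
      (le_ciSup (bddAbove_dualPow k (incl E k U)) f)
      (le_ciSup (bddAbove_dualPow k (incl E k V)) f))

instance (k : ℕ) : SeminormedAddCommGroup (SymTensor E k) :=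
  SeminormedAddCommGroup.ofCore (core k)

instance (k : ℕ) : NormedSpace ℝ (SymTensor E k) where
  norm_smul_le c U := ((core k).norm_smul c U).le

/-- `⊗ᵏ x = x ⊗ ⋯ ⊗ x` as an element of the symmetric algebraic tensor product. -/
def pow (k : ℕ) (x : E) : SymTensor E k :=
  ⟨⨂ₜ[ℝ] _ : Fin k, x, by
    refine Submodule.subset_span ⟨fun _ => x, ?_⟩
    have hk : ((k ! : ℕ) : ℝ) ≠ 0 := Nat.cast_ne_zero.2 (Nat.factorial_ne_zero k)
    simp only [symmetrize, Finset.sum_const, Finset.card_univ, Fintype.card_perm,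
      Fintype.card_fin]
    rw [← Nat.cast_smul_eq_nsmul ℝ, smul_smul, inv_mul_cancel₀ hk, one_smul]⟩

/-- The norm of `∑ λ_j ⊗ᵏ x_j` is `sup {|∑ λ_j f(x_j)ᵏ| : ‖f‖ ≤ 1}`. -/
theorem norm_sum_pow (k M : ℕ) (c : Fin M → ℝ) (x : Fin M → E) :
    ‖∑ j, c j • pow k (x j)‖ =
      ⨆ f : Metric.closedBall (0 : StrongDual ℝ E) 1,
        |∑ j, c j * (f : StrongDual ℝ E) (x j) ^ k| := by
  have h : ∀ y : E, incl E k (pow k y) = ⨂ₜ[ℝ] _ : Fin k, y := fun _ => rfl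
  simp only [norm_def, map_sum, map_smul, h, dualPow_tprod, smul_eq_mul, Finset.prod_const,
    Finset.card_univ, Fintype.card_fin]

end SymTensor

variable (E) in
/-- The `k`-fold symmetric injective tensor product of `E`: the completion of the symmetric
algebraic tensor product in the symmetric injective tensor norm. -/
abbrev SymInjTensor (k : ℕ) : Type u := UniformSpace.Completion (SymTensor E k)

instance (k : ℕ) : MeasurableSpace (SymInjTensor E k) := borel _

instance (k : ℕ) : BorelSpace (SymInjTensor E k) := ⟨rfl⟩

/-- `⊗ᵏ x` in the symmetric injective tensor product. -/
def tensorPow (k : ℕ) (x : E) : SymInjTensor E k := (SymTensor.pow k x : SymTensor E k)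

/-- The injective `k`th moment: the Bochner integral of `⊗ᵏ X`. -/
def injMoment {Ω : Type v} [MeasurableSpace Ω] (k : ℕ) (X : Ω → E) (P : Measure Ω) :
    SymInjTensor E k :=
  ∫ ω, tensorPow k (X ω) ∂P

end SymmetricTensors

/-! ### Rademacher families, type, and the constants -/

/-- The `L_r`-norm `(𝔼 ‖f‖ ^ r) ^ (1 / r)` as a real number, for real `r ≥ 1`. -/
def lrNorm {Ω : Type*} [MeasurableSpace Ω] {F : Type*} [NormedAddCommGroup F]
    (r : ℝ) (f : Ω → F) (μ : Measure Ω) : ℝ :=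
  (eLpNorm f (ENNReal.ofReal r) μ).toReal

/-- Independent random variables `r_0, r_1, …` that are `±1` with probability `1/2` each. -/
structure IsRademacherFamily {Ω : Type*} [MeasurableSpace Ω] (r : ℕ → Ω → ℝ) (μ : Measure Ω) :
    Prop where
  measurable : ∀ j, Measurable (r j)
  values : ∀ j ω, r j ω = -1 ∨ r j ω = 1
  indep : iIndepFun r μ
  prob_neg : ∀ j, μ {ω | r j ω = -1} = 1 / 2
  prob_pos : ∀ j, μ {ω | r j ω = 1} = 1 / 2

/-- `K > 0` satisfies the `(q, p)` Kahane–Khintchine inequality, in all real Banach spaces. -/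
def IsKahaneKhintchineBound (q p K : ℝ) : Prop :=
  0 < K ∧ ∀ (S : Type) [MeasurableSpace S] (μ : Measure S) [IsProbabilityMeasure μ]
    [μ.IsComplete] (r : ℕ → S → ℝ), IsRademacherFamily r μ →
    ∀ (F : Type u) [NormedAddCommGroup F] [NormedSpace ℝ F] [CompleteSpace F]
      (n : ℕ) (x : ℕ → F),
      lrNorm q (fun ω => ∑ j ∈ Finset.range n, r j ω • x j) μ ≤
        K * lrNorm p (fun ω => ∑ j ∈ Finset.range n, r j ω • x j) μ

/-- The `(q, p)` Kahane–Khintchine constant `K_{q,p}`. -/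
def kahaneKhintchineConst (q p : ℝ) : ℝ :=
  sInf {K : ℝ | IsKahaneKhintchineBound.{u} q p K}

/-- `τ > 0` satisfies the Rademacher type `p` inequality in `F`. -/
def IsTypeBound (F : Type u) [NormedAddCommGroup F] [NormedSpace ℝ F] (p τ : ℝ) : Prop :=
  0 < τ ∧ ∀ (S : Type) [MeasurableSpace S] (μ : Measure S) [IsProbabilityMeasure μ]
    [μ.IsComplete] (r : ℕ → S → ℝ), IsRademacherFamily r μ →
    ∀ (n : ℕ) (x : ℕ → F),
      lrNorm p (fun ω => ∑ j ∈ Finset.range n, r j ω • x j) μ ≤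
        τ * (∑ j ∈ Finset.range n, ‖x j‖ ^ p) ^ (1 / p)

/-- `F` has (Rademacher) type `p ∈ [1, 2]`. -/
def HasRademacherType (F : Type u) [NormedAddCommGroup F] [NormedSpace ℝ F] (p : ℝ) : Prop :=
  p ∈ Set.Icc (1 : ℝ) 2 ∧ ∃ τ : ℝ, IsTypeBound F p τ

/-- The type `p` constant `τ_p(F)`. -/
def typeConst (F : Type u) [NormedAddCommGroup F] [NormedSpace ℝ F] (p : ℝ) : ℝ :=
  sInf {τ : ℝ | IsTypeBound F p τ}

/-- `B > 0` satisfies the upper Khintchine inequality with exponent `q`. -/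
def IsKhintchineBound (q B : ℝ) : Prop :=
  0 < B ∧ ∀ (S : Type) [MeasurableSpace S] (μ : Measure S) [IsProbabilityMeasure μ]
    [μ.IsComplete] (r : ℕ → S → ℝ), IsRademacherFamily r μ →
    ∀ (n : ℕ) (a : ℕ → ℝ),
      lrNorm q (fun ω => ∑ j ∈ Finset.range n, r j ω * a j) μ ≤
        B * (∑ j ∈ Finset.range n, a j ^ 2) ^ (1 / 2 : ℝ)

/-- The Khintchine constant `B_q`, i.e. the smallest constant in the upper Khintchine
inequality. -/
def khintchineConst (q : ℝ) : ℝ := sInf {B : ℝ | IsKhintchineBound q B}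

/-- `C^diff_{q,p,k} = 16 k √π K_{q,p} τ_p(E) K_{q,2}`. -/
def diffConst (E : Type u) [NormedAddCommGroup E] [NormedSpace ℝ E] (q p : ℝ) (k : ℕ) : ℝ :=
  16 * k * Real.sqrt Real.pi * kahaneKhintchineConst.{u} q p * typeConst E p *
    kahaneKhintchineConst.{u} q 2

/-- `C^ML_{q,p,k} = 2 max {C^diff_{q,p,k}, B_q}`. -/
def mlConst (E : Type u) [NormedAddCommGroup E] [NormedSpace ℝ E] (q p : ℝ) (k : ℕ) : ℝ :=
  2 * max (diffConst E q p k) (khintchineConst q)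

end

/-! Since `X 0 = 0` and `k ≥ 1`, the expectations of the level differences telescope to the moment
of `X L`. The error is therefore `U` minus this moment, plus one centred Monte Carlo error per
level. Levels are combined only by the triangle inequality, so dependence between them is harmless,
and everything reduces to one level (`lrNorm_level_le`).

On one level, let `X`, `Y` be the two approximations. Symmetrization (`lintegral_pi_center_le`)
replaces the centred sum by sign averages of `⊗ᵏ x_j - ⊗ᵏ y_j`, where `x_j`, `y_j` are sampled
values. Type `p` is known for `E` only, not for the tensor product, so the estimate must be brought
back to `E`. The injective norm is a supremum over functionals `f` in the dual ball of `|∑ ε_j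
(f(x_j)ᵏ - f(y_j)ᵏ)|`. In the variables `s = f(x_j - y_j)`, `t = f(y_j)` the summand is `(t + s)ᵏ -
tᵏ`. With `δ = ‖x_j - y_j‖` and `η = ‖y_j‖` it is Lipschitz in `s` with constant `k (δ + η)^(k-1)`,
and in `t` with the constant `k ((δ + η)^(k-1) - η^(k-1))`, which vanishes with `δ`. A two-parameter
contraction principle (`expect_iSup_contraction`) thus replaces it by two terms linear in `f`, whose
suprema are norms in `E`, and type `p` applies. The lengths of the two weighted vectors add up to `k
((δ + η)ᵏ - ηᵏ)`; the binomial theorem and Hölder turn this into the binomial terms of the bound.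

Contraction controls first moments only. The Kahane–Khintchine inequality, proved here by
hypercontractivity, lifts them to order `q`: `K_{q,2}` leads from 2 to `q`, and the explicit
constant `49/16` from 1 to 2. The total numerical factor is `(49/16) · 4 · 2 · 2 = 49`, which is
below `32 √π`. -/

/-! ### Averages over sign vectors. -/

open scoped BigOperators in
theorem expect_units_int (h : ℤˣ → ℝ) : 𝔼 s, h s = (h 1 + h (-1)) / 2 := by
  rw [Fintype.expect_eq_sum_div_card, UnitsInt.univ]
  simp

open scoped BigOperators in
theorem expect_signs_succ {n : ℕ} (g : (Fin (n + 1) → ℤˣ) → ℝ) :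
    𝔼 ε, g ε = 𝔼 ε : Fin n → ℤˣ, 𝔼 s : ℤˣ, g (Fin.cons s ε) := by
  rw [Finset.expect_comm, ← Finset.expect_product', Finset.univ_product_univ]
  exact Fintype.expect_equiv (Fin.consEquiv fun _ => ℤˣ).symm _ _ fun ε => by simp [Fin.consEquiv]

/-- The signed sum `∑ ε_i x_i`. -/
def signSum {F : Type*} [AddCommGroup F] [Module ℝ F] {n : ℕ} (x : Fin n → F)
    (ε : Fin n → ℤˣ) : F :=
  ∑ i, ((ε i : ℤ) : ℝ) • x i

theorem signSum_cons {F : Type*} [AddCommGroup F] [Module ℝ F] {n : ℕ}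
    (x : Fin (n + 1) → F) (s : ℤˣ) (ε : Fin n → ℤˣ) :
    signSum x (Fin.cons s ε) = ((s : ℤ) : ℝ) • x 0 + signSum (fun i => x i.succ) ε := by
  simp [signSum, Fin.sum_univ_succ]

/-! ### Rademacher families and their reduction to finite sign averages. -/

section Rademacher

variable {S : Type} [MeasurableSpace S] {μ : Measure S} {r : ℕ → S → ℝ}

theorem IsRademacherFamily.measure_signs (h : IsRademacherFamily r μ) {n : ℕ}
    (ε : Fin n → ℤˣ) : μ.real {ω | ∀ i : Fin n, r i ω = ((ε i : ℤ) : ℝ)} = (2 ^ n)⁻¹ := by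
  have hind : iIndepFun (fun i : Fin n => r i) μ := h.indep.precomp Fin.val_injective
  have := hind.measure_inter_preimage_eq_mul (S := Finset.univ)
    (sets := fun i => {((ε i : ℤ) : ℝ)}) (fun i _ => measurableSet_singleton _)
  have h1 : ∀ i : Fin n, μ (r i ⁻¹' {((ε i : ℤ) : ℝ)}) = 2⁻¹ := fun i => by
    rcases Int.units_eq_one_or (ε i) with hi | hi
    · simpa [hi, Set.preimage] using h.prob_pos i
    · simpa [hi, Set.preimage] using h.prob_neg i
  have h2 : {ω | ∀ i : Fin n, r i ω = ((ε i : ℤ) : ℝ)} =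
      ⋂ i ∈ (Finset.univ : Finset (Fin n)), r i ⁻¹' {((ε i : ℤ) : ℝ)} := by
    ext ω; simp
  rw [Measure.real, h2, this, Finset.prod_congr rfl fun i _ => h1 i]
  simp

-- The first `n` variables split the space into `2 ^ n` events of equal probability, one for each
-- sign vector. From here on every statement about Rademacher families becomes a finite average.
open scoped BigOperators in
theorem IsRademacherFamily.integral_eq [IsProbabilityMeasure μ] (h : IsRademacherFamily r μ)
    {n : ℕ} (g : (Fin n → ℝ) → ℝ) :
    ∫ ω, g (fun i => r i ω) ∂μ = 𝔼 ε : Fin n → ℤˣ, g (fun i => ((ε i : ℤ) : ℝ)) := by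
  let A : (Fin n → ℤˣ) → Set S := fun ε => {ω | ∀ i : Fin n, r i ω = ((ε i : ℤ) : ℝ)}
  have hA : ∀ ε, MeasurableSet (A ε) := fun ε => by
    have : A ε = ⋂ i : Fin n, r i ⁻¹' {((ε i : ℤ) : ℝ)} := by ext ω; simp [A]
    rw [this]
    exact MeasurableSet.iInter fun i => h.measurable i (measurableSet_singleton _)
  have hg : ∀ ω, g (fun i => r i ω) =
      ∑ ε, (A ε).indicator (fun _ => g (fun i => ((ε i : ℤ) : ℝ))) ω := fun ω => by
    have hex : ∀ i : Fin n, ∃ s : ℤˣ, r i ω = ((s : ℤ) : ℝ) := fun i => by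
      rcases h.values i ω with hi | hi
      · exact ⟨-1, by simp [hi]⟩
      · exact ⟨1, by simp [hi]⟩
    choose e he using hex
    rw [Finset.sum_eq_single e]
    · rw [Set.indicator_of_mem (show ω ∈ A e from he)]
      simp [he]
    · intro b _ hb
      refine Set.indicator_of_notMem (fun hω => hb ?_) _
      ext i
      have := (hω i).symm.trans (he i)
      exact_mod_cast this
    · simp
  simp_rw [hg]
  rw [integral_finsetSum _ fun ε _ => (integrable_const _).indicator (hA ε)]
  simp_rw [integral_indicator_const _ (hA _), A, h.measure_signs]
  rw [Fintype.expect_eq_sum_div_card, ← Finset.smul_sum]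
  simp [div_eq_inv_mul]

theorem IsRademacherFamily.memLp [IsProbabilityMeasure μ] {F : Type*} [NormedAddCommGroup F]
    [NormedSpace ℝ F]
    (h : IsRademacherFamily r μ) (n : ℕ) (x : ℕ → F) (q : ℝ≥0∞) :
    MemLp (fun ω => ∑ j ∈ Finset.range n, r j ω • x j) q μ := by
  refine memLp_finsetSum _ fun j _ => ?_
  refine MemLp.of_bound ((h.measurable j).aestronglyMeasurable.smul_const _) ‖x j‖
    (Filter.Eventually.of_forall fun ω => ?_)
  rw [norm_smul]
  rcases h.values j ω with hj | hj <;> simp [hj]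

open scoped BigOperators in
theorem IsRademacherFamily.lrNorm_eq [IsProbabilityMeasure μ] (h : IsRademacherFamily r μ)
    {F : Type*} [NormedAddCommGroup F] [NormedSpace ℝ F] {q : ℝ} (hq : 0 < q) (n : ℕ)
    (x : ℕ → F) :
    lrNorm q (fun ω => ∑ j ∈ Finset.range n, r j ω • x j) μ =
      (𝔼 ε, ‖signSum (fun i : Fin n => x i) ε‖ ^ q) ^ q⁻¹ := by
  have hm := h.memLp n x (ENNReal.ofReal q)
  rw [lrNorm, hm.eLpNorm_eq_integral_rpow_norm (by simpa using hq) (by simp),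
    ENNReal.toReal_ofReal hq.le, ENNReal.toReal_ofReal (by positivity)]
  congr 1
  have := h.integral_eq (fun t : Fin n → ℝ => ‖∑ i, t i • x i‖ ^ q)
  simp_rw [Finset.sum_range]
  exact this

theorem IsRademacherFamily.completion (h : IsRademacherFamily r μ) :
    IsRademacherFamily (Ω := NullMeasurableSpace S μ) r μ.completion where
  measurable j _ ht := (h.measurable j ht).nullMeasurableSet
  values := h.values
  indep := by
    refine (iIndepFun_iff_measure_inter_preimage_eq_mul (Ω := NullMeasurableSpace S μ)
      (μ := μ.completion)).2 fun T sets hs => ?_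
    exact h.indep.measure_inter_preimage_eq_mul (S := T) hs
  prob_neg := h.prob_neg
  prob_pos := h.prob_pos

/-- A Rademacher family exists on a complete probability space. -/
theorem exists_isRademacherFamily :
    ∃ (S : Type) (_ : MeasurableSpace S) (μ : Measure S) (r : ℕ → S → ℝ),
      IsProbabilityMeasure μ ∧ μ.IsComplete ∧ IsRademacherFamily r μ := by
  let ν : Measure Bool := (PMF.uniformOfFintype Bool).toMeasure
  have hν : ∀ b, ν {b} = 1 / 2 := fun b => by
    simp [ν]
  let s : Bool → ℝ := fun b => if b then 1 else -1
  let μ : Measure (ℕ → Bool) := Measure.infinitePi fun _ => ν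
  let r : ℕ → (ℕ → Bool) → ℝ := fun j ω => s (ω j)
  have hr : ∀ j, Measurable (r j) := fun j => (measurable_of_countable s).comp (measurable_pi_apply j)
  have hind : iIndepFun r μ :=
    iIndepFun_infinitePi (P := fun _ : ℕ => ν) (X := fun _ => s) fun _ => measurable_of_countable s
  have hev : ∀ j b, μ {ω | ω j = b} = 1 / 2 := fun j b => by
    have := (measurePreserving_eval_infinitePi (fun _ : ℕ => ν) j).measure_preimage
      (measurableSet_singleton b).nullMeasurableSet
    rw [hν] at this
    exact this
  have hR : IsRademacherFamily r μ := by
    refine ⟨hr, fun j ω => ?_, hind, fun j => ?_, fun j => ?_⟩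
    · by_cases hω : ω j = true <;> simp [r, s, hω]
    · rw [← hev j false]
      congr 1; ext ω
      by_cases hω : ω j = true <;> simp [r, s, hω] <;> norm_num
    · rw [← hev j true]
      congr 1; ext ω
      by_cases hω : ω j = true <;> simp [r, s, hω] <;> norm_num
  exact ⟨NullMeasurableSpace (ℕ → Bool) μ, _, μ.completion, r,
    ⟨measure_univ (μ := μ)⟩, inferInstance, hR.completion⟩

end Rademacher

/-! ### Hypercontractivity and comparison of moments of sign sums. -/

section Kahane

open scoped BigOperators

/-- Minkowski's inequality in `L_m` of a fair coin, stated without roots. -/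
theorem half_pow_add_pow_le {m : ℕ} (hm : m ≠ 0) {h₁ h₂ g₁ g₂ B C : ℝ} (hh₁ : 0 ≤ h₁)
    (hh₂ : 0 ≤ h₂) (hg₁ : 0 ≤ g₁) (hg₂ : 0 ≤ g₂) (hB : 0 ≤ B) (hC : 0 ≤ C)
    (hhB : (h₁ ^ m + h₂ ^ m) / 2 ≤ B ^ m) (hgC : (g₁ ^ m + g₂ ^ m) / 2 ≤ C ^ m) :
    ((h₁ + g₁) ^ m + (h₂ + g₂) ^ m) / 2 ≤ (B + C) ^ m := by
  have hm' : (1 : ℝ) ≤ m := by exact_mod_cast Nat.one_le_iff_ne_zero.2 hm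
  have key := Real.Lp_add_le Finset.univ ![h₁, h₂] ![g₁, g₂] hm'
  simp only [Fin.sum_univ_two, Matrix.cons_val_zero, Matrix.cons_val_one, Real.rpow_natCast,
    abs_of_nonneg, hh₁, hh₂, hg₁, hg₂, add_nonneg, one_div] at key
  have root : ∀ {s D : ℝ}, 0 ≤ s → 0 ≤ D → s / 2 ≤ D ^ m →
      s ^ (m : ℝ)⁻¹ ≤ (2 : ℝ) ^ (m : ℝ)⁻¹ * D := fun {s D} hs hD hsD => by
    calc s ^ (m : ℝ)⁻¹ ≤ (2 * D ^ m) ^ (m : ℝ)⁻¹ :=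
          Real.rpow_le_rpow hs (by linarith) (by positivity)
      _ = _ := by rw [Real.mul_rpow (by norm_num) (by positivity), Real.pow_rpow_inv_natCast hD hm]
  have h1 := root (by positivity) hB hhB
  have h2 := root (by positivity) hC hgC
  have h3 : ((h₁ + g₁) ^ m + (h₂ + g₂) ^ m) ^ (m : ℝ)⁻¹ ≤ (2 : ℝ) ^ (m : ℝ)⁻¹ * (B + C) := by
    linarith
  have h4 := pow_le_pow_left₀ (by positivity) h3 m
  rw [Real.rpow_inv_natCast_pow (by positivity) hm, mul_pow,
    Real.rpow_inv_natCast_pow (by norm_num) hm] at h4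
  linarith

/-- Exchanges the average over one sign with the average over the others; this is the tensorization
step of hypercontractivity. -/
theorem half_sum_pow_le {ι : Type*} (s : Finset ι) {m : ℕ} (hm : m ≠ 0) {g h B : ι → ℝ}
    (hg : ∀ i, 0 ≤ g i) (hh : ∀ i, 0 ≤ h i) (hB : ∀ i, 0 ≤ B i)
    (H : ∀ i, (g i ^ m + h i ^ m) / 2 ≤ B i ^ m) :
    ((∑ i ∈ s, g i) ^ m + (∑ i ∈ s, h i) ^ m) / 2 ≤ (∑ i ∈ s, B i) ^ m := by
  classical
  induction s using Finset.induction_on with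
  | empty => simp [hm]
  | insert i s hi ih =>
    simp only [Finset.sum_insert hi]
    exact half_pow_add_pow_le hm (hg i) (hh i) (Finset.sum_nonneg fun i _ => hg i)
      (Finset.sum_nonneg fun i _ => hh i) (hB i) (Finset.sum_nonneg fun i _ => hB i) (H i) ih

variable {F : Type*} [NormedAddCommGroup F] [NormedSpace ℝ F]

/-- The two-point inequality in a normed space follows from the one for real numbers. -/
theorem two_point_norm {m : ℕ} {ρ : ℝ} (hρ0 : 0 ≤ ρ) (hρ1 : ρ ≤ 1)
    (hreal : ∀ u v : ℝ, |v| ≤ u → ((u + ρ * v) ^ (2 * m) + (u - ρ * v) ^ (2 * m)) / 2 ≤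
      (u ^ 2 + v ^ 2) ^ m) (a b : F) :
    (‖a + ρ • b‖ ^ (2 * m) + ‖a - ρ • b‖ ^ (2 * m)) / 2 ≤
      ((‖a + b‖ ^ 2 + ‖a - b‖ ^ 2) / 2) ^ m := by
  set α := ‖a + b‖
  set β := ‖a - b‖
  have hα : 0 ≤ α := norm_nonneg _
  have hβ : 0 ≤ β := norm_nonneg _
  -- `a ± ρ b` are convex combinations of `a + b` and `a - b`. The scalar inequality is then used at
  -- `u = (α + β)/2` and `v = (α - β)/2`, for which `u² + v² = (α² + β²)/2`.
  have h1 : ‖a + ρ • b‖ ≤ (α + β) / 2 + ρ * ((α - β) / 2) := by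
    have e : a + ρ • b = ((1 + ρ) / 2) • (a + b) + ((1 - ρ) / 2) • (a - b) := by module
    calc ‖a + ρ • b‖ ≤ ‖((1 + ρ) / 2) • (a + b)‖ + ‖((1 - ρ) / 2) • (a - b)‖ := by
          rw [e]; exact norm_add_le _ _
      _ = (1 + ρ) / 2 * α + (1 - ρ) / 2 * β := by
          rw [norm_smul, norm_smul, Real.norm_of_nonneg (by linarith),
            Real.norm_of_nonneg (by linarith)]
      _ = _ := by ring
  have h2 : ‖a - ρ • b‖ ≤ (α + β) / 2 - ρ * ((α - β) / 2) := by
    have e : a - ρ • b = ((1 - ρ) / 2) • (a + b) + ((1 + ρ) / 2) • (a - b) := by module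
    calc ‖a - ρ • b‖ ≤ ‖((1 - ρ) / 2) • (a + b)‖ + ‖((1 + ρ) / 2) • (a - b)‖ := by
          rw [e]; exact norm_add_le _ _
      _ = (1 - ρ) / 2 * α + (1 + ρ) / 2 * β := by
          rw [norm_smul, norm_smul, Real.norm_of_nonneg (by linarith),
            Real.norm_of_nonneg (by linarith)]
      _ = _ := by ring
  calc _ ≤ (((α + β) / 2 + ρ * ((α - β) / 2)) ^ (2 * m) +
        ((α + β) / 2 - ρ * ((α - β) / 2)) ^ (2 * m)) / 2 := by gcongr
    _ ≤ _ := hreal _ _ (abs_le.2 ⟨by linarith, by linarith⟩)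
    _ = _ := by congr 1; ring

/-- Hypercontractivity of vector-valued Rademacher sums. -/
theorem hypercontractive {m : ℕ} (hm : m ≠ 0) {ρ : ℝ} (hρ0 : 0 ≤ ρ) (hρ1 : ρ ≤ 1)
    (hreal : ∀ u v : ℝ, |v| ≤ u → ((u + ρ * v) ^ (2 * m) + (u - ρ * v) ^ (2 * m)) / 2 ≤
      (u ^ 2 + v ^ 2) ^ m) {n : ℕ} (x : Fin n → F) (a : F) :
    𝔼 ε, ‖a + ρ • signSum x ε‖ ^ (2 * m) ≤ (𝔼 ε, ‖a + signSum x ε‖ ^ 2) ^ m := by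
  induction n generalizing a with
  | zero => simp [signSum, pow_mul]
  | succ n ih =>
    -- On the left the first sign is averaged last, so its term joins the shift `a` and the
    -- induction hypothesis applies for each value of that sign.
    rw [expect_signs_succ, expect_signs_succ, Finset.expect_comm, expect_units_int]
    simp only [signSum_cons, expect_units_int]
    set T : (Fin n → ℤˣ) → F := signSum fun i => x i.succ
    have e : ∀ (s : ℤˣ) ε, a + ρ • (((s : ℤ) : ℝ) • x 0 + T ε) =
        (a + ρ • ((s : ℤ) : ℝ) • x 0) + ρ • T ε := fun s ε => by module
    simp only [e]
    refine (div_le_div_of_nonneg_right (add_le_add (ih (fun i => x i.succ) _)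
      (ih (fun i => x i.succ) _)) (by norm_num)).trans ?_
    change ((𝔼 ε, ‖_ + T ε‖ ^ 2) ^ m + (𝔼 ε, ‖_ + T ε‖ ^ 2) ^ m) / 2 ≤ _
    simp only [Fintype.expect_eq_sum_div_card, div_pow]
    rw [← add_div, div_right_comm]
    gcongr
    -- Minkowski leaves a two-point inequality in `x 0` for each fixed choice of the remaining
    -- signs.
    refine half_sum_pow_le _ hm (fun _ => by positivity) (fun _ => by positivity)
      (fun _ => by positivity) fun ε => ?_
    have := two_point_norm hρ0 hρ1 hreal (a + T ε) (x 0)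
    simp only [pow_mul] at this
    have f1 : a + T ε + ρ • x 0 = a + ρ • (((1 : ℤˣ) : ℤ) : ℝ) • x 0 + T ε := by
      push_cast; module
    have f2 : a + T ε - ρ • x 0 = a + ρ • (((-1 : ℤˣ) : ℤ) : ℝ) • x 0 + T ε := by
      push_cast; module
    have f3 : a + T ε + x 0 = a + ((((1 : ℤˣ) : ℤ) : ℝ) • x 0 + T ε) := by
      push_cast; module
    have f4 : a + T ε - x 0 = a + ((((-1 : ℤˣ) : ℤ) : ℝ) • x 0 + T ε) := by
      push_cast; module
    rwa [f1, f2, f3, f4] at this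

/-- The only critical coefficient is that of `u² v²`: `6 (4/7)² = 96/49 < 2`. The value `4/7` is a
rational just below the bound `1/√3`. -/
theorem two_point_four (u v : ℝ) :
    ((u + 4 / 7 * v) ^ (2 * 2) + (u - 4 / 7 * v) ^ (2 * 2)) / 2 ≤ (u ^ 2 + v ^ 2) ^ 2 := by
  nlinarith [sq_nonneg (u * v), sq_nonneg (v ^ 2)]

/-- Scaling to `u = 1`, `v = t` with `|t| ≤ 1`, one has `(1 ± t/(2m))^(2m) ≤ exp (±t)`, and `cosh t
≤ exp (t²/2) ≤ 1 + t²`. The resulting contraction parameter is crude, but any finite moment constant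
suffices. -/
theorem two_point_even {m : ℕ} (hm : m ≠ 0) (u v : ℝ) (huv : |v| ≤ u) :
    ((u + 1 / (2 * m) * v) ^ (2 * m) + (u - 1 / (2 * m) * v) ^ (2 * m)) / 2 ≤
      (u ^ 2 + v ^ 2) ^ m := by
  rcases (abs_nonneg v).trans huv |>.eq_or_lt with hu | hu
  · have : v = 0 := abs_eq_zero.1 (le_antisymm (huv.trans hu.symm.le) (abs_nonneg v))
    simp [this, ← hu, hm]
  have hm1 : (1 : ℝ) ≤ m := by exact_mod_cast Nat.one_le_iff_ne_zero.2 hm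
  obtain ⟨t, rfl⟩ : ∃ t, v = u * t := ⟨v / u, by field_simp⟩
  have ht : |t| ≤ 1 := by
    rw [abs_mul, abs_of_pos hu] at huv
    nlinarith
  have ht2 : t ^ 2 ≤ 1 := by rw [← sq_abs]; nlinarith [abs_nonneg t]
  obtain ⟨ht3, ht4⟩ := abs_le.1 ht
  set w := 1 / (2 * (m : ℝ)) * t with hw
  have hmw : 2 * (m : ℝ) * w = t := by rw [hw]; field_simp
  have hw1 : -1 ≤ w := by nlinarith
  have hw2 : w ≤ 1 := by nlinarith
  have b1 : (1 + w) ^ (2 * m) ≤ Real.exp t := by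
    calc (1 + w) ^ (2 * m) ≤ Real.exp w ^ (2 * m) :=
          pow_le_pow_left₀ (by linarith) (by linarith [Real.add_one_le_exp w]) _
      _ = Real.exp t := by rw [← Real.exp_nat_mul]; push_cast; rw [hmw]
  have b2 : (1 - w) ^ (2 * m) ≤ Real.exp (-t) := by
    calc (1 - w) ^ (2 * m) ≤ Real.exp (-w) ^ (2 * m) :=
          pow_le_pow_left₀ (by linarith) (by linarith [Real.add_one_le_exp (-w)]) _
      _ = Real.exp (-t) := by rw [← Real.exp_nat_mul]; push_cast; rw [mul_neg, hmw]
  -- With `c = t²/2 ≤ 1/2`: `exp c ≤ 1/(1 - c) ≤ 1 + 2c`.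
  have b3 : Real.exp (t ^ 2 / 2) ≤ 1 + t ^ 2 := by
    have h := Real.add_one_le_exp (-(t ^ 2 / 2))
    have hpos := Real.exp_pos (t ^ 2 / 2)
    have h1 : Real.exp (t ^ 2 / 2) * Real.exp (-(t ^ 2 / 2)) = 1 := by
      rw [← Real.exp_add]; simp
    have h2 : Real.exp (t ^ 2 / 2) * (1 - t ^ 2 / 2) ≤ 1 := by nlinarith
    by_contra! hc
    nlinarith [sq_nonneg t]
  have e1 : (u + 1 / (2 * m) * (u * t)) = u * (1 + w) := by rw [hw]; ring
  have e2 : (u - 1 / (2 * m) * (u * t)) = u * (1 - w) := by rw [hw]; ring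
  have e3 : u ^ 2 + (u * t) ^ 2 = u ^ 2 * (1 + t ^ 2) := by ring
  rw [e1, e2, e3, mul_pow, mul_pow, mul_pow (u ^ 2), ← pow_mul, ← mul_add, mul_div_assoc]
  refine mul_le_mul_of_nonneg_left ?_ (by positivity)
  calc ((1 + w) ^ (2 * m) + (1 - w) ^ (2 * m)) / 2 ≤ Real.cosh t := by
        rw [Real.cosh_eq]; linarith
    _ ≤ Real.exp (t ^ 2 / 2) := Real.cosh_le_exp_half_sq t
    _ ≤ 1 + t ^ 2 := b3
    _ ≤ (1 + t ^ 2) ^ m := le_self_pow₀ (by nlinarith [sq_nonneg t]) hm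

/-- Moments of even order of a Rademacher sum are bounded by the second moment. -/
theorem expect_signSum_pow_le {m : ℕ} (hm : m ≠ 0) {n : ℕ} (x : Fin n → F) :
    𝔼 ε, ‖signSum x ε‖ ^ (2 * m) ≤ (2 * m) ^ (2 * m) * (𝔼 ε, ‖signSum x ε‖ ^ 2) ^ m := by
  have hm1 : (1 : ℝ) ≤ m := by exact_mod_cast Nat.one_le_iff_ne_zero.2 hm
  have hm2 : 1 / (2 * (m : ℝ)) ≤ 1 := by rw [div_le_one] <;> linarith
  have h := hypercontractive hm (by positivity) hm2 (two_point_even hm) x 0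
  simp only [zero_add, norm_smul, mul_pow, ← Finset.mul_expect] at h
  rw [Real.norm_of_nonneg (by positivity), one_div, inv_pow, inv_mul_le_iff₀ (by positivity)] at h
  exact h

/-- The fourth moment of a Rademacher sum is bounded by the second moment. -/
theorem expect_signSum_pow_four_le {n : ℕ} (x : Fin n → F) :
    𝔼 ε, ‖signSum x ε‖ ^ 4 ≤ (7 / 4) ^ 4 * (𝔼 ε, ‖signSum x ε‖ ^ 2) ^ 2 := by
  have h := hypercontractive (m := 2) two_ne_zero (ρ := 4 / 7) (by norm_num) (by norm_num)
    (fun u v _ => two_point_four u v) x 0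
  simp only [zero_add, norm_smul, mul_pow, ← Finset.mul_expect] at h
  norm_num at h ⊢
  linarith

/-- The second moment of a Rademacher sum is bounded by the first moment. -/
theorem sqrt_expect_signSum_sq_le {n : ℕ} (x : Fin n → F) :
    (𝔼 ε, ‖signSum x ε‖ ^ 2) ^ (2 : ℝ)⁻¹ ≤ 49 / 16 * 𝔼 ε, ‖signSum x ε‖ := by
  have h4 := expect_signSum_pow_four_le x
  set E2 := 𝔼 ε, ‖signSum x ε‖ ^ 2
  set E1 := 𝔼 ε, ‖signSum x ε‖
  have hE2 : 0 ≤ E2 := Finset.expect_nonneg fun _ _ => by positivity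
  have hE1 : 0 ≤ E1 := Finset.expect_nonneg fun _ _ => by positivity
  rw [← one_div, ← Real.sqrt_eq_rpow]
  set s := √E2
  have hs : 0 ≤ s := Real.sqrt_nonneg _
  have hs2 : s ^ 2 = E2 := Real.sq_sqrt hE2
  have key : 3 * (49 / 16 * s) ^ 2 * E2 ≤ 2 * (49 / 16 * s) ^ 3 * E1 + 𝔼 ε, ‖signSum x ε‖ ^ 4 := by
    rw [Finset.mul_expect, Finset.mul_expect, ← Finset.expect_add_distrib]
    refine Finset.expect_le_expect fun ε _ => ?_
    have : 0 ≤ ‖signSum x ε‖ * (‖signSum x ε‖ - 49 / 16 * s) ^ 2 * (‖signSum x ε‖ + 2 * (49 / 16 * s)) := by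
      positivity
    linarith
  rw [← hs2] at key h4
  have h5 : s ^ 3 * s ≤ s ^ 3 * (49 / 16 * E1) := by nlinarith
  rcases hs.eq_or_lt with h0 | h0
  · rw [← h0]; positivity
  · exact le_of_mul_le_mul_left h5 (by positivity)

end Kahane

/-! ### The optimal constants: finiteness, lower bounds, attainment. -/

section Constants

open scoped BigOperators

theorem lrNorm_mono_exponent {S F : Type*} [MeasurableSpace S] {μ : Measure S}
    [IsProbabilityMeasure μ] [NormedAddCommGroup F] {f : S → F} {r s : ℝ} (hrs : r ≤ s)
    (hf : MemLp f (ENNReal.ofReal s) μ) : lrNorm r f μ ≤ lrNorm s f μ :=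
  ENNReal.toReal_mono hf.eLpNorm_ne_top
    (eLpNorm_le_eLpNorm_of_exponent_le (ENNReal.ofReal_le_ofReal hrs) hf.aestronglyMeasurable)

/-- An infimum of admissible constants is itself admissible. Nonemptiness is essential, as the real
infimum of the empty set is `0`. -/
theorem le_sInf_mul {s : Set ℝ} (hs : s.Nonempty) {a b : ℝ} (hb : 0 ≤ b)
    (h : ∀ K ∈ s, a ≤ K * b) : a ≤ sInf s * b := by
  rcases hb.eq_or_lt with rfl | hb
  · obtain ⟨K, hK⟩ := hs
    simpa using h K hK
  · rw [← div_le_iff₀ hb]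
    exact le_csInf hs fun K hK => (div_le_iff₀ hb).2 (h K hK)

theorem exists_nat_extension {F : Type*} [Zero F] {n : ℕ} (x : Fin n → F) :
    ∃ y : ℕ → F, (fun i : Fin n => y i) = x :=
  ⟨fun j => if h : j < n then x ⟨j, h⟩ else 0, by ext i; simp⟩

/-- The Kahane–Khintchine inequality. -/
theorem exists_isKahaneKhintchineBound (q : ℝ) {p : ℝ} (hp : 1 ≤ p) :
    ∃ K, IsKahaneKhintchineBound.{u} q p K := by
  obtain ⟨m, hm⟩ := exists_nat_ge (max q 1)
  have hm1 : (1 : ℝ) ≤ m := (le_max_right _ _).trans hm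
  have hm0 : m ≠ 0 := by rintro rfl; norm_num at hm1
  refine ⟨2 * m * (49 / 16), by positivity, ?_⟩
  intro S _ μ _ _ r hr F _ _ _ n x
  set f := fun ω => ∑ j ∈ Finset.range n, r j ω • x j
  have h1 : lrNorm q f μ ≤ lrNorm (2 * m : ℕ) f μ := by
    refine lrNorm_mono_exponent ?_ (hr.memLp n x _)
    push_cast
    linarith [le_max_left q 1]
  have h2 : lrNorm (2 * m : ℕ) f μ ≤ 2 * m * lrNorm 2 f μ := by
    rw [hr.lrNorm_eq (by positivity), hr.lrNorm_eq two_pos]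
    simp only [Real.rpow_natCast, Real.rpow_ofNat]
    have h := expect_signSum_pow_le hm0 fun i : Fin n => x i
    have hE : 0 ≤ 𝔼 ε, ‖signSum (fun i : Fin n => x i) ε‖ ^ 2 :=
      Finset.expect_nonneg fun _ _ => by positivity
    refine (Real.rpow_le_rpow (Finset.expect_nonneg fun _ _ => by positivity) h
      (by positivity)).trans_eq ?_
    have e1 : ((2 * m : ℝ) ^ (2 * m)) ^ ((2 * m : ℕ) : ℝ)⁻¹ = 2 * m :=
      Real.pow_rpow_inv_natCast (by positivity) (by positivity)
    have e2 : (m : ℝ) * ((2 * m : ℕ) : ℝ)⁻¹ = 2⁻¹ := by push_cast; field_simp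
    rw [Real.mul_rpow (by positivity) (by positivity), e1, ← Real.rpow_natCast_mul hE, e2]
  have h3 : lrNorm 2 f μ ≤ 49 / 16 * lrNorm 1 f μ := by
    rw [hr.lrNorm_eq one_pos, hr.lrNorm_eq two_pos]
    simpa using sqrt_expect_signSum_sq_le fun i : Fin n => x i
  have h4 : lrNorm 1 f μ ≤ lrNorm p f μ := lrNorm_mono_exponent hp (hr.memLp n x _)
  calc lrNorm q f μ ≤ 2 * m * lrNorm 2 f μ := h1.trans h2
    _ ≤ 2 * m * (49 / 16 * lrNorm p f μ) := by gcongr; linarith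
    _ = _ := by ring

/-- A single unit vector has all moments equal to 1. `ULift` puts the real line into the universe
over which the constant quantifies. -/
theorem one_le_kahaneKhintchineConst {p q : ℝ} (hp : 1 ≤ p) (hq : 0 < q) :
    1 ≤ kahaneKhintchineConst.{u} q p := by
  refine le_csInf (exists_isKahaneKhintchineBound q hp) fun K hK => ?_
  obtain ⟨S, _, μ, r, _, _, hr⟩ := exists_isRademacherFamily
  have h := hK.2 S μ r hr (ULift.{u} ℝ) 1 fun _ => ULift.up 1
  have e : ∀ ε, ‖signSum (fun _ : Fin 1 => ULift.up.{u} (1 : ℝ)) ε‖ = 1 := fun ε => by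
    rcases Int.units_eq_one_or (ε 0) with h | h <;> simp [signSum, h, ULift.norm_def]
  rw [hr.lrNorm_eq hq, hr.lrNorm_eq (by linarith)] at h
  simpa [e] using h

theorem rpow_expect_signSum_le_kahaneKhintchineConst {F : Type u} [NormedAddCommGroup F]
    [NormedSpace ℝ F] [CompleteSpace F] {q : ℝ} (hq : 0 < q) {n : ℕ} (x : Fin n → F) :
    (𝔼 ε, ‖signSum x ε‖ ^ q) ^ q⁻¹ ≤
      kahaneKhintchineConst.{u} q 2 * (𝔼 ε, ‖signSum x ε‖ ^ 2) ^ (2 : ℝ)⁻¹ := by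
  refine le_sInf_mul (exists_isKahaneKhintchineBound q one_le_two)
    (Real.rpow_nonneg (Finset.expect_nonneg fun _ _ => by positivity) _) fun K hK => ?_
  obtain ⟨S, _, μ, r, _, _, hr⟩ := exists_isRademacherFamily
  obtain ⟨y, rfl⟩ := exists_nat_extension x
  have h := hK.2 S μ r hr F n y
  rw [hr.lrNorm_eq hq, hr.lrNorm_eq two_pos] at h
  simpa using h

theorem typeConst_nonneg (E : Type u) [NormedAddCommGroup E] [NormedSpace ℝ E] (p : ℝ) :
    0 ≤ typeConst E p :=
  Real.sInf_nonneg fun _ h => h.1.le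

theorem expect_signSum_le_typeConst {E : Type u} [NormedAddCommGroup E] [NormedSpace ℝ E]
    {p : ℝ} (hE : HasRademacherType E p) {n : ℕ} (x : Fin n → E) :
    𝔼 ε, ‖signSum x ε‖ ≤ typeConst E p * (∑ i, ‖x i‖ ^ p) ^ (1 / p) := by
  refine le_sInf_mul hE.2 (by positivity) fun K hK => ?_
  obtain ⟨S, _, μ, r, _, _, hr⟩ := exists_isRademacherFamily
  obtain ⟨y, rfl⟩ := exists_nat_extension x
  have h := (lrNorm_mono_exponent hE.1.1 (hr.memLp n y _)).trans (hK.2 S μ r hr n y)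
  rw [hr.lrNorm_eq one_pos, Finset.sum_range] at h
  simpa using h

end Constants

/-! ### Talagrand contraction with two comparison processes. -/

section Contraction

open scoped BigOperators

/-- A real-valued function with bounded range. -/
def BddFun {T : Type*} (h : T → ℝ) : Prop := ∃ C, ∀ t, |h t| ≤ C

namespace BddFun

variable {T : Type*} {g h : T → ℝ}

theorem add (hg : BddFun g) (hh : BddFun h) : BddFun (g + h) := by
  obtain ⟨a, ha⟩ := hg
  obtain ⟨b, hb⟩ := hh
  exact ⟨a + b, fun t => (abs_add_le _ _).trans (add_le_add (ha t) (hb t))⟩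

theorem smul (c : ℝ) (hh : BddFun h) : BddFun (c • h) := by
  obtain ⟨b, hb⟩ := hh
  exact ⟨|c| * b, fun t => by
    rw [Pi.smul_apply, smul_eq_mul, abs_mul]
    exact mul_le_mul_of_nonneg_left (hb t) (abs_nonneg _)⟩

theorem zero : BddFun (0 : T → ℝ) := ⟨0, fun t => by simp⟩

theorem signSum {n : ℕ} {w : Fin n → T → ℝ} (hw : ∀ j, BddFun (w j)) (ε : Fin n → ℤˣ) :
    BddFun (signSum w ε) :=
  Finset.sum_induction _ BddFun (fun _ _ => add) zero fun j _ => (hw j).smul _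

theorem le_ciSup (hh : BddFun h) (t : T) : h t ≤ ⨆ t, h t := by
  obtain ⟨b, hb⟩ := hh
  exact _root_.le_ciSup (f := h)
    ⟨b, by rintro _ ⟨t, rfl⟩; exact (le_abs_self _).trans (hb t)⟩ t

end BddFun

variable {T : Type*} [Nonempty T]

/-- The sum of the two suprema on the left is a supremum over pairs `t, s` of `g t + g s + w t - w
s`. Choose signs that turn `|u t - u s| + |v t - v s|` into a linear expression. That sign pattern
tested at `t` and its opposite at `s` produce the increments; in the other two patterns, averaged
over `t` and `s`, the terms in `u` and `v` cancel. Only two of four patterns contribute, hence the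
factor 2. -/
theorem expect_iSup_contraction_one {g w u v : T → ℝ} (hg : BddFun g) (hu : BddFun u)
    (hv : BddFun v) (H : ∀ t s, |w t - w s| ≤ |u t - u s| + |v t - v s|) :
    𝔼 s : ℤˣ, ⨆ t, (g + ((s : ℤ) : ℝ) • w) t ≤
      𝔼 s : ℤˣ, 𝔼 s' : ℤˣ,
        ⨆ t, (g + ((s : ℤ) : ℝ) • (2 : ℝ) • u + ((s' : ℤ) : ℝ) • (2 : ℝ) • v) t := by
  have hb : ∀ (s s' : ℤˣ) t,
      (g + ((s : ℤ) : ℝ) • (2 : ℝ) • u + ((s' : ℤ) : ℝ) • (2 : ℝ) • v) t ≤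
      ⨆ t, (g + ((s : ℤ) : ℝ) • (2 : ℝ) • u + ((s' : ℤ) : ℝ) • (2 : ℝ) • v) t := fun s s' =>
    ((hg.add ((hu.smul _).smul _)).add ((hv.smul _).smul _)).le_ciSup
  simp only [expect_units_int]
  have h1 := hb 1 1
  have h2 := hb 1 (-1)
  have h3 := hb (-1) 1
  have h4 := hb (-1) (-1)
  set S₁ := ⨆ t, (g + (((1 : ℤˣ) : ℤ) : ℝ) • (2 : ℝ) • u +
    (((1 : ℤˣ) : ℤ) : ℝ) • (2 : ℝ) • v) t
  set S₂ := ⨆ t, (g + (((1 : ℤˣ) : ℤ) : ℝ) • (2 : ℝ) • u +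
    (((-1 : ℤˣ) : ℤ) : ℝ) • (2 : ℝ) • v) t
  set S₃ := ⨆ t, (g + (((-1 : ℤˣ) : ℤ) : ℝ) • (2 : ℝ) • u +
    (((1 : ℤˣ) : ℤ) : ℝ) • (2 : ℝ) • v) t
  set S₄ := ⨆ t, (g + (((-1 : ℤˣ) : ℤ) : ℝ) • (2 : ℝ) • u +
    (((-1 : ℤˣ) : ℤ) : ℝ) • (2 : ℝ) • v) t
  simp only [Pi.add_apply, Pi.smul_apply, smul_eq_mul, Units.val_one, Units.val_neg,
    Int.cast_one, Int.cast_neg, one_mul, neg_mul] at h1 h2 h3 h4 ⊢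
  have key : (⨆ t, (g t + w t)) + ⨆ t, (g t + -w t) ≤ (S₁ + S₂ + S₃ + S₄) / 2 := by
    refine ciSup_add_ciSup_le fun t s => ?_
    have := (le_abs_self _).trans (H t s)
    have a1 := h1 t
    have a2 := h2 t
    have a3 := h3 t
    have a4 := h4 t
    have b1 := h1 s
    have b2 := h2 s
    have b3 := h3 s
    have b4 := h4 s
    rcases abs_cases (u t - u s) with ⟨hu, _⟩ | ⟨hu, _⟩ <;>
    rcases abs_cases (v t - v s) with ⟨hv, _⟩ | ⟨hv, _⟩ <;>
    rw [hu, hv] at this <;> linarith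
  linarith

/-- A two-parameter version of Talagrand's contraction principle. -/
theorem expect_iSup_contraction {n : ℕ} {h : T → ℝ} {w u v : Fin n → T → ℝ} (hh : BddFun h)
    (hw : ∀ j, BddFun (w j)) (hu : ∀ j, BddFun (u j)) (hv : ∀ j, BddFun (v j))
    (H : ∀ j t s, |w j t - w j s| ≤ |u j t - u j s| + |v j t - v j s|) :
    𝔼 ε, ⨆ t, (h + signSum w ε) t ≤
      𝔼 ε, 𝔼 ε', ⨆ t, (h + (2 : ℝ) • signSum u ε + (2 : ℝ) • signSum v ε') t := by
  induction n generalizing h with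
  | zero => simp [signSum]
  | succ n ih =>
    simp only [expect_signs_succ, signSum_cons]
    calc _ = 𝔼 ε, 𝔼 s : ℤˣ, ⨆ t, ((h + signSum (fun j => w j.succ) ε) +
          ((s : ℤ) : ℝ) • w 0) t := by
          simp only [add_assoc, add_comm (signSum (fun j => w j.succ) _)]
      -- The first coordinate is contracted with all other signs frozen; its replacement then enters
      -- the free shift `h` of the induction hypothesis.
      _ ≤ 𝔼 ε, 𝔼 s : ℤˣ, 𝔼 s' : ℤˣ, ⨆ t, ((h + signSum (fun j => w j.succ) ε) +
          ((s : ℤ) : ℝ) • (2 : ℝ) • u 0 + ((s' : ℤ) : ℝ) • (2 : ℝ) • v 0) t :=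
          Finset.expect_le_expect fun ε _ => expect_iSup_contraction_one
            (hh.add (BddFun.signSum (fun j => hw j.succ) ε)) (hu 0) (hv 0) (H 0)
      _ = 𝔼 s : ℤˣ, 𝔼 s' : ℤˣ, 𝔼 ε, ⨆ t, ((h + ((s : ℤ) : ℝ) • (2 : ℝ) • u 0 +
          ((s' : ℤ) : ℝ) • (2 : ℝ) • v 0) + signSum (fun j => w j.succ) ε) t := by
          rw [Finset.expect_comm]
          refine Finset.expect_congr rfl fun s _ => ?_
          rw [Finset.expect_comm]
          refine Finset.expect_congr rfl fun s' _ => Finset.expect_congr rfl fun ε _ => ?_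
          congr 2
          ext t
          simp only [Pi.add_apply]
          ring
      _ ≤ 𝔼 s : ℤˣ, 𝔼 s' : ℤˣ, 𝔼 ε, 𝔼 ε', ⨆ t, ((h + ((s : ℤ) : ℝ) • (2 : ℝ) • u 0 +
          ((s' : ℤ) : ℝ) • (2 : ℝ) • v 0) + (2 : ℝ) • signSum (fun j => u j.succ) ε +
          (2 : ℝ) • signSum (fun j => v j.succ) ε') t :=
          Finset.expect_le_expect fun s _ => Finset.expect_le_expect fun s' _ =>
            ih ((hh.add (((hu 0).smul _).smul _)).add (((hv 0).smul _).smul _))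
              (fun j => hw j.succ) (fun j => hu j.succ) (fun j => hv j.succ) fun j => H j.succ
      _ = _ := by
          have e : ∀ s : ℤˣ, (𝔼 s' : ℤˣ, 𝔼 ε, 𝔼 ε', ⨆ t, ((h + ((s : ℤ) : ℝ) • (2 : ℝ) • u 0 +
              ((s' : ℤ) : ℝ) • (2 : ℝ) • v 0) + (2 : ℝ) • signSum (fun j => u j.succ) ε +
              (2 : ℝ) • signSum (fun j => v j.succ) ε') t) =
              𝔼 ε, 𝔼 ε', 𝔼 s' : ℤˣ, ⨆ t, ((h + ((s : ℤ) : ℝ) • (2 : ℝ) • u 0 +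
              ((s' : ℤ) : ℝ) • (2 : ℝ) • v 0) + (2 : ℝ) • signSum (fun j => u j.succ) ε +
              (2 : ℝ) • signSum (fun j => v j.succ) ε') t := fun s => by
            rw [Finset.expect_comm]
            exact Finset.expect_congr rfl fun ε _ => Finset.expect_comm _ _ _
          simp only [e]
          rw [Finset.expect_comm]
          refine Finset.expect_congr rfl fun ε _ => Finset.expect_congr rfl fun s _ =>
            Finset.expect_congr rfl fun ε' _ => Finset.expect_congr rfl fun s' _ => ?_
          congr 2
          module

end Contraction

/-! ### Scalar estimates for differences of powers. -/

theorem abs_add_pow_sub_pow_le (m : ℕ) {s t δ η : ℝ} (hs : |s| ≤ δ) (ht : |t| ≤ η) :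
    |(t + s) ^ m - t ^ m| ≤ (δ + η) ^ m - η ^ m := by
  have hδ := (abs_nonneg s).trans hs
  have hη := (abs_nonneg t).trans ht
  induction m with
  | zero => simp
  | succ m ih =>
    calc |(t + s) ^ (m + 1) - t ^ (m + 1)| = |(t + s) * ((t + s) ^ m - t ^ m) + s * t ^ m| := by
          congr 1; ring
      _ ≤ |t + s| * |(t + s) ^ m - t ^ m| + |s| * |t| ^ m := by
          rw [← abs_pow, ← abs_mul, ← abs_mul]; exact abs_add_le _ _
      _ ≤ (δ + η) * ((δ + η) ^ m - η ^ m) + δ * η ^ m := by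
          gcongr
          exact (abs_add_le _ _).trans (by linarith)
      _ = _ := by ring

/-- Bounds the partial derivatives of `(s, t) ↦ (t + s)ᵏ - tᵏ`, moving first in `s` and then in `t`.
The `t`-derivative is itself a difference of powers, so its bound is small when `δ` is. -/
theorem abs_add_pow_sub_pow_sub_le (k : ℕ) {s s' t t' δ η : ℝ} (hs : |s| ≤ δ) (hs' : |s'| ≤ δ)
    (ht : |t| ≤ η) (ht' : |t'| ≤ η) :
    |((t + s) ^ k - t ^ k) - ((t' + s') ^ k - t' ^ k)| ≤
      k * (δ + η) ^ (k - 1) * |s - s'| + k * ((δ + η) ^ (k - 1) - η ^ (k - 1)) * |t - t'| := by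
  have h1 : |(t + s) ^ k - (t + s') ^ k| ≤ k * (δ + η) ^ (k - 1) * |s - s'| := by
    refine (abs_pow_sub_pow_le _ _ _).trans ?_
    have hmax : max |t + s| |t + s'| ≤ δ + η :=
      max_le ((abs_add_le _ _).trans (by linarith)) ((abs_add_le _ _).trans (by linarith))
    calc _ ≤ |t + s - (t + s')| * k * (δ + η) ^ (k - 1) := by gcongr
      _ = _ := by rw [add_sub_add_left_eq_sub]; ring
  have h2 : ‖((t + s') ^ k - t ^ k) - ((t' + s') ^ k - t' ^ k)‖ ≤
      k * ((δ + η) ^ (k - 1) - η ^ (k - 1)) * ‖t - t'‖ := by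
    refine (convex_Icc (-η) η).norm_image_sub_le_of_norm_hasDerivWithin_le
      (f := fun t => (t + s') ^ k - t ^ k)
      (f' := fun t => k * (t + s') ^ (k - 1) * 1 - k * t ^ (k - 1) * 1)
      (fun r _ => ?_) (fun r hr => ?_) (abs_le.1 ht') (abs_le.1 ht)
    · exact ((((hasDerivAt_id r).add_const s').pow k).sub
        ((hasDerivAt_id r).pow k)).hasDerivWithinAt
    · have := abs_add_pow_sub_pow_le (k - 1) hs' (abs_le.2 hr)
      rw [mul_one, mul_one, ← mul_sub, norm_mul, Real.norm_natCast]
      exact mul_le_mul_of_nonneg_left this (Nat.cast_nonneg k)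
  calc _ = |((t + s) ^ k - (t + s') ^ k) +
        (((t + s') ^ k - t ^ k) - ((t' + s') ^ k - t' ^ k))| := by congr 1; ring
    _ ≤ _ := (abs_add_le _ _).trans (add_le_add h1 h2)

/-! ### Tensor powers in the injective norm and the passage back to `E`. -/

section TensorPower

open scoped BigOperators

variable {E : Type u} [NormedAddCommGroup E] [NormedSpace ℝ E]

theorem SymTensor.dualPow_pow (k : ℕ) (f : StrongDual ℝ E) (x : E) :
    dualPow k f (incl E k (pow k x)) = f x ^ k := by
  have h : incl E k (pow k x) = ⨂ₜ[ℝ] _ : Fin k, x := rfl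
  simp [h]

theorem abs_apply_le_of_mem_closedBall (f : Metric.closedBall (0 : StrongDual ℝ E) 1) (x : E) :
    |(f : StrongDual ℝ E) x| ≤ ‖x‖ := by
  have h := (f : StrongDual ℝ E).le_of_opNorm_le (mem_closedBall_zero_iff.1 f.2) x
  simpa using h

theorem norm_tensorPow_sub_le (k : ℕ) (x y : E) :
    ‖tensorPow k x - tensorPow k y‖ ≤ (‖x - y‖ + ‖y‖) ^ k - ‖y‖ ^ k := by
  have : Nonempty (Metric.closedBall (0 : StrongDual ℝ E) 1) := ⟨⟨0, by simp⟩⟩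
  rw [tensorPow, tensorPow, ← UniformSpace.Completion.coe_sub, UniformSpace.Completion.norm_coe,
    SymTensor.norm_def]
  refine ciSup_le fun f => ?_
  rw [map_sub, map_sub, SymTensor.dualPow_pow, SymTensor.dualPow_pow]
  have h := abs_add_pow_sub_pow_le k (abs_apply_le_of_mem_closedBall f (x - y))
    (abs_apply_le_of_mem_closedBall f y)
  rwa [map_sub, add_sub_cancel] at h

theorem tensorPow_zero {k : ℕ} (hk : k ≠ 0) : tensorPow k (0 : E) = 0 := by
  have h : SymTensor.pow k (0 : E) = 0 := by
    have : NeZero k := ⟨hk⟩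
    exact Subtype.ext ((PiTensorProduct.tprod ℝ).map_coord_zero (0 : Fin k) rfl)
  rw [tensorPow, h, UniformSpace.Completion.coe_zero]

theorem norm_tensorPow_le {k : ℕ} (hk : k ≠ 0) (x : E) : ‖tensorPow k x‖ ≤ ‖x‖ ^ k := by
  simpa [tensorPow_zero hk, hk] using norm_tensorPow_sub_le k x 0

theorem continuous_tensorPow (k : ℕ) : Continuous (tensorPow k : E → SymInjTensor E k) := by
  refine continuous_iff_continuousAt.2 fun y => ?_
  refine tendsto_iff_norm_sub_tendsto_zero.2 ?_
  refine squeeze_zero (fun _ => norm_nonneg _) (fun x => norm_tensorPow_sub_le k x y) ?_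
  have : Continuous fun x : E => (‖x - y‖ + ‖y‖) ^ k - ‖y‖ ^ k := by fun_prop
  simpa using this.tendsto y

theorem norm_signSum_tensorPow_sub (k : ℕ) {n : ℕ} (x y : Fin n → E) (ε : Fin n → ℤˣ) :
    ‖signSum (fun j => tensorPow k (x j) - tensorPow k (y j)) ε‖ =
      ⨆ f : Metric.closedBall (0 : StrongDual ℝ E) 1,
        |signSum (fun j (f : Metric.closedBall (0 : StrongDual ℝ E) 1) =>
          (f : StrongDual ℝ E) (x j) ^ k - (f : StrongDual ℝ E) (y j) ^ k) ε f| := by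
  have e : signSum (fun j => tensorPow k (x j) - tensorPow k (y j)) ε =
      UniformSpace.Completion.toComplₗᵢ (𝕜 := ℝ)
        (signSum (fun j => SymTensor.pow k (x j) - SymTensor.pow k (y j)) ε) := by
    rw [signSum, signSum, map_sum]
    exact Finset.sum_congr rfl fun j _ => by rw [map_smul, map_sub]; rfl
  rw [e, LinearIsometry.norm_map, SymTensor.norm_def]
  simp [signSum, SymTensor.dualPow_pow]

/-- The Rademacher average of differences of tensor powers is controlled by the Rademacher
averages of two sequences in `E`. -/
theorem expect_norm_signSum_tensorPow_le {k : ℕ} (hk : k ≠ 0) {n : ℕ} (x y : Fin n → E) :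
    𝔼 ε, ‖signSum (fun j => tensorPow k (x j) - tensorPow k (y j)) ε‖ ≤
      4 * (𝔼 ε, ‖signSum (fun j =>
          (k * (‖x j - y j‖ + ‖y j‖) ^ (k - 1)) • (x j - y j)) ε‖ +
        𝔼 ε, ‖signSum (fun j =>
          (k * ((‖x j - y j‖ + ‖y j‖) ^ (k - 1) - ‖y j‖ ^ (k - 1))) • y j) ε‖) := by
  let T := Metric.closedBall (0 : StrongDual ℝ E) 1
  let f₀ : T := ⟨0, Metric.mem_closedBall_self zero_le_one⟩
  have : Nonempty T := ⟨f₀⟩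
  let a : Fin n → E := fun j => (k * (‖x j - y j‖ + ‖y j‖) ^ (k - 1)) • (x j - y j)
  let b : Fin n → E := fun j =>
    (k * ((‖x j - y j‖ + ‖y j‖) ^ (k - 1) - ‖y j‖ ^ (k - 1))) • y j
  let w : Fin n → T → ℝ := fun j f => (f : StrongDual ℝ E) (x j) ^ k - (f : StrongDual ℝ E) (y j) ^ k
  let u : Fin n → T → ℝ := fun j f => (f : StrongDual ℝ E) (a j)
  let v : Fin n → T → ℝ := fun j f => (f : StrongDual ℝ E) (b j)
  have hu : ∀ j, BddFun (u j) := fun j => ⟨_, fun f => abs_apply_le_of_mem_closedBall f _⟩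
  have hv : ∀ j, BddFun (v j) := fun j => ⟨_, fun f => abs_apply_le_of_mem_closedBall f _⟩
  have hw : ∀ j, BddFun (w j) := fun j => ⟨_, fun f => by
    have h := abs_add_pow_sub_pow_le k (abs_apply_le_of_mem_closedBall f (x j - y j))
      (abs_apply_le_of_mem_closedBall f (y j))
    rwa [map_sub, add_sub_cancel] at h⟩
  have H : ∀ j t s, |w j t - w j s| ≤ |u j t - u j s| + |v j t - v j s| := fun j t s => by
    have h := abs_add_pow_sub_pow_sub_le k (abs_apply_le_of_mem_closedBall t (x j - y j))
      (abs_apply_le_of_mem_closedBall s (x j - y j)) (abs_apply_le_of_mem_closedBall t (y j))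
      (abs_apply_le_of_mem_closedBall s (y j))
    have hA : 0 ≤ (‖x j - y j‖ + ‖y j‖) ^ (k - 1) - ‖y j‖ ^ (k - 1) :=
      sub_nonneg.2 (pow_le_pow_left₀ (norm_nonneg _) (by linarith [norm_nonneg (x j - y j)]) _)
    have hB : ∀ {c : ℝ} (hc : 0 ≤ c) (z : E), |(t : StrongDual ℝ E) (c • z) -
        (s : StrongDual ℝ E) (c • z)| = c * |(t : StrongDual ℝ E) z - (s : StrongDual ℝ E) z| :=
      fun {c} hc z => by
        rw [map_smul, map_smul, smul_eq_mul, smul_eq_mul, ← mul_sub, abs_mul, abs_of_nonneg hc]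
    change |_| ≤ |(t : StrongDual ℝ E) (a j) - (s : StrongDual ℝ E) (a j)| +
      |(t : StrongDual ℝ E) (b j) - (s : StrongDual ℝ E) (b j)|
    rw [hB (by positivity), hB (mul_nonneg (Nat.cast_nonneg k) hA)]
    simpa only [map_sub, add_sub_cancel] using h
  have hcon := expect_iSup_contraction (h := 0) BddFun.zero hw hu hv H
  simp only [zero_add] at hcon
  -- Since `k ≠ 0`, the process vanishes at the functional `0`, so both one-sided suprema are
  -- nonnegative and their sum dominates the supremum of the absolute value. By sign symmetry this
  -- costs a factor 2; contraction costs another 2.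
  have hsup : ∀ ε, ‖signSum (fun j => tensorPow k (x j) - tensorPow k (y j)) ε‖ ≤
      (⨆ f, signSum w ε f) + ⨆ f, signSum w (-ε) f := fun ε => by
    rw [norm_signSum_tensorPow_sub]
    have h0 : ∀ ε, signSum w ε f₀ = 0 := fun ε => by simp [signSum, w, f₀, hk]
    have hb := fun ε => (BddFun.signSum hw ε).le_ciSup
    have p1 := hb ε f₀
    have p2 := hb (-ε) f₀
    rw [h0] at p1 p2
    refine ciSup_le fun f => abs_le.2 ⟨?_, ?_⟩
    · have := hb (-ε) f
      have e : signSum w (-ε) f = - signSum w ε f := by simp [signSum]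
      change - _ ≤ signSum w ε f
      linarith
    · change signSum w ε f ≤ _
      linarith [hb ε f]
  have hsym : 𝔼 ε, (⨆ f, signSum w (-ε) f) = 𝔼 ε, ⨆ f, signSum w ε f :=
    Fintype.expect_equiv (Equiv.neg _) _ _ fun _ => rfl
  have hR : ∀ ε ε', (⨆ f, ((2 : ℝ) • signSum u ε + (2 : ℝ) • signSum v ε') f) ≤
      2 * ‖signSum a ε‖ + 2 * ‖signSum b ε'‖ := fun ε ε' => by
    refine ciSup_le fun f => ?_
    have e1 : signSum u ε f = (f : StrongDual ℝ E) (signSum a ε) := by simp [signSum, u]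
    have e2 : signSum v ε' f = (f : StrongDual ℝ E) (signSum b ε') := by simp [signSum, v]
    have h1 := (le_abs_self _).trans (abs_apply_le_of_mem_closedBall f (signSum a ε))
    have h2 := (le_abs_self _).trans (abs_apply_le_of_mem_closedBall f (signSum b ε'))
    simp only [Pi.add_apply, Pi.smul_apply, smul_eq_mul, e1, e2]
    linarith
  calc _ ≤ 𝔼 ε, ((⨆ f, signSum w ε f) + ⨆ f, signSum w (-ε) f) :=
        Finset.expect_le_expect fun ε _ => hsup ε
    _ = 2 * 𝔼 ε, ⨆ f, signSum w ε f := by rw [Finset.expect_add_distrib, hsym]; ring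
    _ ≤ 2 * 𝔼 ε, 𝔼 ε', (2 * ‖signSum a ε‖ + 2 * ‖signSum b ε'‖) := by
        refine mul_le_mul_of_nonneg_left ?_ two_pos.le
        exact hcon.trans (Finset.expect_le_expect fun ε _ =>
          Finset.expect_le_expect fun ε' _ => hR ε ε')
    _ = _ := by
        simp only [Finset.expect_add_distrib, Fintype.expect_const, ← Finset.mul_expect]
        ring

/-- The weight `k ((δ + η)ᵏ - ηᵏ)`. -/
def diffWeight (k : ℕ) (δ η : ℝ) : ℝ := k * ((δ + η) ^ k - η ^ k)

/-- The term `ηᵏ` cancels, leaving a factor `δ` in every summand; this is where the level difference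
enters the final bound. -/
theorem diffWeight_eq_sum (k : ℕ) (δ η : ℝ) : diffWeight k δ η =
    k * ∑ i ∈ Finset.range k, (k.choose (i + 1) : ℝ) * (δ ^ (i + 1) * η ^ (k - 1 - i)) := by
  rw [diffWeight, add_pow, Finset.sum_range_succ']
  congr 1
  simp only [pow_zero, Nat.sub_zero, Nat.choose_zero_right, Nat.cast_one, mul_one, one_mul,
    add_sub_cancel_right]
  refine Finset.sum_congr rfl fun i _ => ?_
  rw [Nat.sub_sub, add_comm 1 i]
  ring

theorem diffWeight_nonneg (k : ℕ) {δ η : ℝ} (hδ : 0 ≤ δ) (hη : 0 ≤ η) : 0 ≤ diffWeight k δ η :=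
  mul_nonneg (Nat.cast_nonneg k) (sub_nonneg.2 (pow_le_pow_left₀ hη (by linarith) _))

/-- The `q`-th moment of a Rademacher sum of differences of tensor powers in a space of type
`p`. -/
theorem rpow_expect_signSum_tensorPow_le {p q : ℝ} (hE : HasRademacherType E p) (hq : 0 < q)
    {k : ℕ} (hk : k ≠ 0) {n : ℕ} (x y : Fin n → E) :
    (𝔼 ε, ‖signSum (fun j => tensorPow k (x j) - tensorPow k (y j)) ε‖ ^ q) ^ q⁻¹ ≤
      49 / 2 * kahaneKhintchineConst.{u} q 2 * typeConst E p *
        (∑ j, diffWeight k ‖x j - y j‖ ‖y j‖ ^ p) ^ (1 / p) := by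
  have hp : 0 < p := by linarith [hE.1.1]
  have hK : 0 ≤ kahaneKhintchineConst.{u} q 2 :=
    zero_le_one.trans (one_le_kahaneKhintchineConst one_le_two hq)
  have h1 := rpow_expect_signSum_le_kahaneKhintchineConst hq
    fun j => tensorPow k (x j) - tensorPow k (y j)
  have h2 := sqrt_expect_signSum_sq_le fun j => tensorPow k (x j) - tensorPow k (y j)
  have h3 := expect_norm_signSum_tensorPow_le hk x y
  have hB : ∀ j, 0 ≤ (‖x j - y j‖ + ‖y j‖) ^ (k - 1) - ‖y j‖ ^ (k - 1) := fun j =>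
    sub_nonneg.2 (pow_le_pow_left₀ (norm_nonneg _) (by linarith [norm_nonneg (x j - y j)]) _)
  -- The lengths of the two weighted vectors add up to the weight, so each is at most the weight.
  have hW : ∀ j, k * (‖x j - y j‖ + ‖y j‖) ^ (k - 1) * ‖x j - y j‖ +
      k * ((‖x j - y j‖ + ‖y j‖) ^ (k - 1) - ‖y j‖ ^ (k - 1)) * ‖y j‖ =
      diffWeight k ‖x j - y j‖ ‖y j‖ := fun j => by
    obtain ⟨m, rfl⟩ := Nat.exists_eq_succ_of_ne_zero hk
    simp only [diffWeight, Nat.succ_eq_add_one, Nat.add_sub_cancel]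
    ring
  have hnn : ∀ j, 0 ≤ k * ((‖x j - y j‖ + ‖y j‖) ^ (k - 1) - ‖y j‖ ^ (k - 1)) := fun j =>
    mul_nonneg (Nat.cast_nonneg k) (hB j)
  have h4 := expect_signSum_le_typeConst hE fun j =>
    (k * (‖x j - y j‖ + ‖y j‖) ^ (k - 1)) • (x j - y j)
  have h5 := expect_signSum_le_typeConst hE fun j =>
    (k * ((‖x j - y j‖ + ‖y j‖) ^ (k - 1) - ‖y j‖ ^ (k - 1))) • y j
  have h6 : (∑ j, ‖(k * (‖x j - y j‖ + ‖y j‖) ^ (k - 1)) • (x j - y j)‖ ^ p) ^ (1 / p) ≤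
      (∑ j, diffWeight k ‖x j - y j‖ ‖y j‖ ^ p) ^ (1 / p) := by
    gcongr with j
    rw [norm_smul, Real.norm_of_nonneg (by positivity), ← hW]
    exact le_add_of_nonneg_right (mul_nonneg (hnn j) (norm_nonneg _))
  have h7 : (∑ j, ‖(k * ((‖x j - y j‖ + ‖y j‖) ^ (k - 1) - ‖y j‖ ^ (k - 1))) • y j‖ ^ p) ^
      (1 / p) ≤ (∑ j, diffWeight k ‖x j - y j‖ ‖y j‖ ^ p) ^ (1 / p) := by
    gcongr with j
    rw [norm_smul, Real.norm_of_nonneg (hnn j), ← hW]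
    exact le_add_of_nonneg_left (by positivity)
  have hτ := typeConst_nonneg E p
  set D := (∑ j, diffWeight k ‖x j - y j‖ ‖y j‖ ^ p) ^ (1 / p)
  have h8 := mul_le_mul_of_nonneg_left h6 hτ
  have h9 := mul_le_mul_of_nonneg_left h7 hτ
  -- `49/2 = (49/16) · 4 · 2`: second to first moment, contraction with symmetry, and two vectors
  -- each bounded by `D`.
  have h10 : (𝔼 ε, ‖signSum (fun j => tensorPow k (x j) - tensorPow k (y j)) ε‖ ^ 2) ^ (2 : ℝ)⁻¹ ≤
      49 / 2 * (typeConst E p * D) := by linarith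
  exact (h1.trans (mul_le_mul_of_nonneg_left h10 hK)).trans_eq (by ring)

end TensorPower

/-! ### Symmetrization on product spaces. -/

section Symmetrization

variable {Ω : Type v} [MeasurableSpace Ω] {P : Measure Ω} [IsProbabilityMeasure P]
  {F : Type u} [NormedAddCommGroup F] [NormedSpace ℝ F]

theorem enorm_integral_rpow_le {g : Ω → F} (hg : AEStronglyMeasurable g P) {q : ℝ} (hq : 1 ≤ q) :
    ‖∫ ω, g ω ∂P‖ₑ ^ q ≤ ∫⁻ ω, ‖g ω‖ₑ ^ q ∂P := by
  have h1 := enorm_integral_le_lintegral_enorm (μ := P) g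
  have h2 := eLpNorm'_le_eLpNorm'_of_exponent_le one_pos hq P hg
  simp only [eLpNorm', ENNReal.rpow_one, div_one] at h2
  calc ‖∫ ω, g ω ∂P‖ₑ ^ q ≤ ((∫⁻ ω, ‖g ω‖ₑ ^ q ∂P) ^ (1 / q)) ^ q :=
        ENNReal.rpow_le_rpow (h1.trans h2) (by linarith)
    _ = _ := by rw [← ENNReal.rpow_mul, one_div_mul_cancel (by linarith), ENNReal.rpow_one]

theorem lintegral_pi_succ {n : ℕ} {g : (Fin (n + 1) → Ω) → ℝ≥0∞} (hg : Measurable g) :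
    ∫⁻ w, g w ∂(Measure.pi fun _ => P) =
      ∫⁻ ω, ∫⁻ w, g (Fin.cons ω w) ∂(Measure.pi fun _ : Fin n => P) ∂P := by
  have h := (measurePreserving_piFinSuccAbove (fun _ : Fin (n + 1) => P) 0).symm
  rw [← h.lintegral_comp hg,
    lintegral_prod (fun z => g ((MeasurableEquiv.piFinSuccAbove (fun _ => Ω) 0).symm z))
      (hg.comp h.measurable).aemeasurable]
  simp [MeasurableEquiv.piFinSuccAbove_symm_apply, Fin.insertNthEquiv]

theorem measurable_cons {n : ℕ} :
    Measurable fun z : Ω × (Fin n → Ω) => (Fin.cons z.1 z.2 : Fin (n + 1) → Ω) := by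
  refine measurable_pi_iff.2 fun i => ?_
  refine Fin.cases ?_ (fun j => ?_) i
  · simpa using measurable_fst
  · simp only [Fin.cons_succ]
    fun_prop

/-- Jensen replaces the mean by an independent copy `ζ'`. Then `a + ζ - ζ'` is the midpoint of `a +
2ζ` and `a - 2ζ'`, and convexity of the `q`-th power separates the copies. The arbitrary shift `a`
permits treating one coordinate at a time. -/
theorem two_mul_lintegral_center_le [CompleteSpace F] {ζ : Ω → F} (hζ : StronglyMeasurable ζ)
    (hint : Integrable ζ P) {q : ℝ} (hq : 1 ≤ q) (a : F) :
    2 * ∫⁻ ω, ‖a + (ζ ω - ∫ ω', ζ ω' ∂P)‖ₑ ^ q ∂P ≤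
      ∑ s : ℤˣ, ∫⁻ ω, ‖a + (2 : ℝ) • ((s : ℤ) : ℝ) • ζ ω‖ₑ ^ q ∂P := by
  have hms : ∀ s : ℤˣ, Measurable fun ω => ‖a + (2 : ℝ) • ((s : ℤ) : ℝ) • ζ ω‖ₑ ^ q := fun s =>
    (stronglyMeasurable_const.add ((hζ.const_smul _).const_smul _)).enorm.pow_const _
  have hpt : ∀ ω, 2 * ‖a + (ζ ω - ∫ ω', ζ ω' ∂P)‖ₑ ^ q ≤
      ‖a + (2 : ℝ) • (((1 : ℤˣ) : ℤ) : ℝ) • ζ ω‖ₑ ^ q +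
        ∫⁻ ω', ‖a + (2 : ℝ) • (((-1 : ℤˣ) : ℤ) : ℝ) • ζ ω'‖ₑ ^ q ∂P := fun ω => by
    have e : a + (ζ ω - ∫ ω', ζ ω' ∂P) = ∫ ω', (a + (ζ ω - ζ ω')) ∂P := by
      have hsub : Integrable (fun ω' => ζ ω - ζ ω') P := (integrable_const _).sub hint
      rw [integral_add (integrable_const _) hsub, integral_sub (integrable_const _) hint]
      simp
    have hj := enorm_integral_rpow_le (P := P) (g := fun ω' => a + (ζ ω - ζ ω'))
      ((stronglyMeasurable_const.add (stronglyMeasurable_const.sub hζ)).aestronglyMeasurable) hq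
    have hc : ∀ ω', 2 * ‖a + (ζ ω - ζ ω')‖ₑ ^ q ≤
        ‖a + (2 : ℝ) • (((1 : ℤˣ) : ℤ) : ℝ) • ζ ω‖ₑ ^ q +
          ‖a + (2 : ℝ) • (((-1 : ℤˣ) : ℤ) : ℝ) • ζ ω'‖ₑ ^ q := fun ω' => by
      have e2 : a + (ζ ω - ζ ω') = (2⁻¹ : ℝ) • (a + (2 : ℝ) • (((1 : ℤˣ) : ℤ) : ℝ) • ζ ω) +
          (2⁻¹ : ℝ) • (a + (2 : ℝ) • (((-1 : ℤˣ) : ℤ) : ℝ) • ζ ω') := by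
        push_cast; module
      have e3 : ∀ z : F, ‖(2⁻¹ : ℝ) • z‖ₑ = 2⁻¹ * ‖z‖ₑ := fun z => by
        rw [enorm_smul, ← ofReal_norm, Real.norm_of_nonneg (by norm_num)]
        simp [ENNReal.ofReal_inv_of_pos]
      have h1 := (enorm_add_le (E := F) ((2⁻¹ : ℝ) • (a + (2 : ℝ) • (((1 : ℤˣ) : ℤ) : ℝ) • ζ ω))
        ((2⁻¹ : ℝ) • (a + (2 : ℝ) • (((-1 : ℤˣ) : ℤ) : ℝ) • ζ ω')))
      rw [← e2, e3, e3] at h1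
      have h2 := (ENNReal.rpow_le_rpow h1 (by linarith : 0 ≤ q)).trans
        (ENNReal.rpow_arith_mean_le_arith_mean2_rpow _ _ _ _ ENNReal.inv_two_add_inv_two hq)
      calc _ ≤ 2 * (_ + _) := mul_le_mul_right h2 2
        _ = _ := by
          rw [← mul_add, ← mul_assoc, ENNReal.mul_inv_cancel two_ne_zero ENNReal.ofNat_ne_top,
            one_mul]
    rw [e]
    calc _ ≤ 2 * ∫⁻ ω', ‖a + (ζ ω - ζ ω')‖ₑ ^ q ∂P := mul_le_mul_right hj 2
      _ = ∫⁻ ω', 2 * ‖a + (ζ ω - ζ ω')‖ₑ ^ q ∂P := (lintegral_const_mul' _ _ (by simp)).symm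
      _ ≤ _ := lintegral_mono hc
      _ = _ := by rw [lintegral_add_left measurable_const]; simp
  rw [UnitsInt.univ, Finset.sum_pair (by decide), ← lintegral_const_mul' _ _ (by simp)]
  refine (lintegral_mono hpt).trans_eq ?_
  rw [lintegral_add_left (hms 1)]
  simp

theorem stronglyMeasurable_smul_signSum {ζ : Ω → F} (hζ : StronglyMeasurable ζ) {n : ℕ}
    (ε : Fin n → ℤˣ) :
    StronglyMeasurable fun w : Fin n → Ω => (2 : ℝ) • signSum (fun j => ζ (w j)) ε :=
  StronglyMeasurable.const_smul (Finset.stronglyMeasurable_fun_sum _ fun j _ =>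
    (hζ.comp_measurable (measurable_pi_apply j)).const_smul _) _

/-- Symmetrization for sums of independent copies on a product space. -/
theorem lintegral_pi_center_le [CompleteSpace F] {ζ : Ω → F} (hζ : StronglyMeasurable ζ)
    (hint : Integrable ζ P) {q : ℝ} (hq : 1 ≤ q) (n : ℕ) (a : F) :
    2 ^ n * ∫⁻ w, ‖a + ∑ j, (ζ (w j) - ∫ ω, ζ ω ∂P)‖ₑ ^ q ∂(Measure.pi fun _ : Fin n => P) ≤
      ∑ ε, ∫⁻ w, ‖a + (2 : ℝ) • signSum (fun j => ζ (w j)) ε‖ₑ ^ q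
        ∂(Measure.pi fun _ : Fin n => P) := by
  induction n generalizing a with
  | zero => simp [signSum]
  | succ n ih =>
    set m := ∫ ω, ζ ω ∂P
    have hsum : ∀ (l : ℕ), StronglyMeasurable fun w : Fin l → Ω => ∑ j, (ζ (w j) - m) := fun l =>
      Finset.stronglyMeasurable_fun_sum _ fun j _ =>
        (hζ.comp_measurable (measurable_pi_apply j)).sub stronglyMeasurable_const
    have hsig : ∀ (l : ℕ) (ε : Fin l → ℤˣ),
        StronglyMeasurable fun w : Fin l → Ω => (2 : ℝ) • signSum (fun j => ζ (w j)) ε :=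
      fun l ε => stronglyMeasurable_smul_signSum hζ ε
    have hm1 : Measurable fun w : Fin (n + 1) → Ω => ‖a + ∑ j, (ζ (w j) - m)‖ₑ ^ q :=
      (stronglyMeasurable_const.add (hsum _)).enorm.pow_const _
    have hm2 : ∀ ε, Measurable fun w : Fin (n + 1) → Ω =>
        ‖a + (2 : ℝ) • signSum (fun j => ζ (w j)) ε‖ₑ ^ q := fun ε =>
      (stronglyMeasurable_const.add (hsig _ ε)).enorm.pow_const _
    have hm3 : ∀ ε : Fin n → ℤˣ, Measurable fun z : Ω × (Fin n → Ω) =>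
        ‖a + (ζ z.1 - m) + (2 : ℝ) • signSum (fun j => ζ (z.2 j)) ε‖ₑ ^ q := fun ε =>
      ((stronglyMeasurable_const.add ((hζ.comp_measurable measurable_fst).sub
        stronglyMeasurable_const)).add
        ((hsig n ε).comp_measurable measurable_snd)).enorm.pow_const _
    calc 2 ^ (n + 1) * ∫⁻ w, ‖a + ∑ j, (ζ (w j) - m)‖ₑ ^ q ∂(Measure.pi fun _ => P)
        = 2 * ∫⁻ ω, 2 ^ n * ∫⁻ w, ‖(a + (ζ ω - m)) + ∑ j, (ζ (w j) - m)‖ₑ ^ q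
            ∂(Measure.pi fun _ : Fin n => P) ∂P := by
          rw [lintegral_pi_succ hm1, lintegral_const_mul' _ _ (by simp), ← mul_assoc, pow_succ']
          simp only [Fin.sum_univ_succ, Fin.cons_zero, Fin.cons_succ, add_assoc]
      _ ≤ 2 * ∫⁻ ω, ∑ ε, ∫⁻ w, ‖(a + (ζ ω - m)) + (2 : ℝ) • signSum (fun j => ζ (w j)) ε‖ₑ ^ q
            ∂(Measure.pi fun _ : Fin n => P) ∂P :=
          mul_le_mul_right (lintegral_mono fun ω => ih _) 2
      -- After Fubini the other coordinates, already symmetrized, play the role of the shift for the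
      -- first one.
      _ = ∑ ε, ∫⁻ w, 2 * ∫⁻ ω, ‖(a + (2 : ℝ) • signSum (fun j => ζ (w j)) ε) + (ζ ω - m)‖ₑ ^ q ∂P
            ∂(Measure.pi fun _ : Fin n => P) := by
          rw [lintegral_finsetSum _ fun ε _ => (hm3 ε).lintegral_prod_right', Finset.mul_sum]
          refine Finset.sum_congr rfl fun ε _ => ?_
          rw [lintegral_const_mul' _ _ (by simp), lintegral_lintegral_swap (hm3 ε).aemeasurable]
          simp only [add_right_comm a]
      _ ≤ ∑ ε, ∫⁻ w, ∑ s : ℤˣ, ∫⁻ ω, ‖(a + (2 : ℝ) • signSum (fun j => ζ (w j)) ε) +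
            (2 : ℝ) • ((s : ℤ) : ℝ) • ζ ω‖ₑ ^ q ∂P ∂(Measure.pi fun _ : Fin n => P) :=
          Finset.sum_le_sum fun ε _ => lintegral_mono fun w =>
            two_mul_lintegral_center_le hζ hint hq _
      _ = ∑ ε, ∑ s : ℤˣ, ∫⁻ w, ‖a + (2 : ℝ) • signSum (fun j => ζ (w j)) (Fin.cons s ε)‖ₑ ^ q
            ∂(Measure.pi fun _ : Fin (n + 1) => P) := by
          refine Finset.sum_congr rfl fun ε _ => ?_
          have e : ∀ (s : ℤˣ) ω (w : Fin n → Ω),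
              (a + (2 : ℝ) • signSum (fun j => ζ (w j)) ε) + (2 : ℝ) • ((s : ℤ) : ℝ) • ζ ω =
              a + (2 : ℝ) • signSum (fun j => ζ ((Fin.cons ω w : Fin (n + 1) → Ω) j))
                (Fin.cons s ε) := fun s ω w => by
            rw [signSum_cons]
            simp only [Fin.cons_zero, Fin.cons_succ]
            module
          have hm4 : ∀ s : ℤˣ, Measurable fun z : Ω × (Fin n → Ω) =>
              ‖(a + (2 : ℝ) • signSum (fun j => ζ (z.2 j)) ε) +
                (2 : ℝ) • ((s : ℤ) : ℝ) • ζ z.1‖ₑ ^ q := fun s => by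
            simp only [e]
            exact (hm2 (Fin.cons s ε)).comp measurable_cons
          rw [lintegral_finsetSum _ fun s _ => (hm4 s).lintegral_prod_left']
          refine Finset.sum_congr rfl fun s _ => ?_
          rw [lintegral_pi_succ (hm2 _), ← lintegral_lintegral_swap (hm4 s).aemeasurable]
          simp only [e]
      _ = _ := by
          rw [Finset.sum_comm, ← Finset.sum_product', Finset.univ_product_univ]
          exact Fintype.sum_equiv (Fin.consEquiv fun _ => ℤˣ) _ _ fun z => rfl

end Symmetrization

/-! ### The Monte Carlo error of one level. -/

section LevelEstimate

open scoped BigOperators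

variable {E : Type u} [NormedAddCommGroup E] [NormedSpace ℝ E]

/-- As `q ≥ p`, the power mean inequality converts `(∑ Wᵖ)^(q/p)` into `n^(q/p - 1) ∑ W^q`, which
can be integrated term by term. Over identically distributed samples the powers of `n` combine to
`n^(q/p)`. -/
theorem expect_signSum_tensorPow_rpow_le {p q : ℝ} (hE : HasRademacherType E p) (hpq : p ≤ q)
    {k : ℕ} (hk : k ≠ 0) {n : ℕ} (x y : Fin n → E) :
    𝔼 ε, ‖signSum (fun j => tensorPow k (x j) - tensorPow k (y j)) ε‖ ^ q ≤
      (49 / 2 * kahaneKhintchineConst.{u} q 2 * typeConst E p) ^ q * ((n : ℝ) ^ (q / p - 1) *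
        ∑ j, diffWeight k ‖x j - y j‖ ‖y j‖ ^ q) := by
  have hp : 0 < p := by linarith [hE.1.1]
  have hq : 0 < q := hp.trans_le hpq
  have hK : 0 ≤ kahaneKhintchineConst.{u} q 2 :=
    zero_le_one.trans (one_le_kahaneKhintchineConst one_le_two hq)
  have hτ := typeConst_nonneg E p
  have hW : ∀ j, 0 ≤ diffWeight k ‖x j - y j‖ ‖y j‖ := fun j =>
    diffWeight_nonneg k (norm_nonneg _) (norm_nonneg _)
  have h1 := rpow_expect_signSum_tensorPow_le hE hq hk x y
  have h0 : 0 ≤ 𝔼 ε, ‖signSum (fun j => tensorPow k (x j) - tensorPow k (y j)) ε‖ ^ q :=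
    Finset.expect_nonneg fun _ _ => by positivity
  have hs : 0 ≤ ∑ j, diffWeight k ‖x j - y j‖ ‖y j‖ ^ p :=
    Finset.sum_nonneg fun j _ => Real.rpow_nonneg (hW j) _
  have h2 := Real.rpow_le_rpow (Real.rpow_nonneg h0 _) h1 hq.le
  rw [Real.rpow_inv_rpow h0 hq.ne', Real.mul_rpow (by positivity) (by positivity),
    ← Real.rpow_mul hs] at h2
  refine h2.trans (mul_le_mul_of_nonneg_left ?_ (by positivity))
  have h3 := Real.rpow_sum_le_const_mul_sum_rpow_of_nonneg (s := Finset.univ)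
    (f := fun j => diffWeight k ‖x j - y j‖ ‖y j‖ ^ p) (p := q / p) ((one_le_div hp).2 hpq)
    fun j _ => Real.rpow_nonneg (hW j) _
  rw [one_div_mul_eq_div]
  simpa [← Real.rpow_mul (hW _), mul_div_cancel₀ _ hp.ne'] using h3

theorem sum_enorm_signSum_tensorPow_rpow_le {p q : ℝ} (hE : HasRademacherType E p) (hpq : p ≤ q)
    {k : ℕ} (hk : k ≠ 0) {n : ℕ} (x y : Fin n → E) :
    ∑ ε, ‖(2 : ℝ) • signSum (fun j => tensorPow k (x j) - tensorPow k (y j)) ε‖ₑ ^ q ≤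
      2 ^ n * (ENNReal.ofReal ((49 * kahaneKhintchineConst.{u} q 2 * typeConst E p) ^ q *
        (n : ℝ) ^ (q / p - 1)) * ∑ j, ‖diffWeight k ‖x j - y j‖ ‖y j‖‖ₑ ^ q) := by
  have hp : 0 < p := by linarith [hE.1.1]
  have hq : 0 < q := hp.trans_le hpq
  have hK : 0 ≤ kahaneKhintchineConst.{u} q 2 :=
    zero_le_one.trans (one_le_kahaneKhintchineConst one_le_two hq)
  have hτ := typeConst_nonneg E p
  have hW : ∀ j, 0 ≤ diffWeight k ‖x j - y j‖ ‖y j‖ := fun j =>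
    diffWeight_nonneg k (norm_nonneg _) (norm_nonneg _)
  have e1 : ∀ z : SymInjTensor E k, ‖(2 : ℝ) • z‖ₑ ^ q = ENNReal.ofReal (2 ^ q * ‖z‖ ^ q) :=
    fun z => by
      rw [← ofReal_norm, norm_smul, ENNReal.ofReal_rpow_of_nonneg (by positivity) hq.le,
        Real.mul_rpow (by positivity) (by positivity)]
      simp
  have e2 : ∀ j, ‖diffWeight k ‖x j - y j‖ ‖y j‖‖ₑ ^ q =
      ENNReal.ofReal (diffWeight k ‖x j - y j‖ ‖y j‖ ^ q) := fun j => by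
    rw [← ofReal_norm, Real.norm_of_nonneg (hW j), ENNReal.ofReal_rpow_of_nonneg (hW j) hq.le]
  have e3 : (2 : ℝ≥0∞) ^ n = ENNReal.ofReal (2 ^ n) := by
    rw [ENNReal.ofReal_pow (by norm_num)]; simp
  have hs : 0 ≤ ∑ j, diffWeight k ‖x j - y j‖ ‖y j‖ ^ q :=
    Finset.sum_nonneg fun j _ => Real.rpow_nonneg (hW j) _
  simp only [e1, e2]
  rw [e3, ← ENNReal.ofReal_sum_of_nonneg fun ε _ => by positivity,
    ← ENNReal.ofReal_sum_of_nonneg fun j _ => Real.rpow_nonneg (hW j) _,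
    ← ENNReal.ofReal_mul (by positivity), ← ENNReal.ofReal_mul (by positivity)]
  refine ENNReal.ofReal_le_ofReal ?_
  have h := expect_signSum_tensorPow_rpow_le hE hpq hk x y
  rw [Fintype.expect_eq_sum_div_card, div_le_iff₀ (by positivity)] at h
  have hcard : (Fintype.card (Fin n → ℤˣ) : ℝ) = 2 ^ n := by simp
  rw [hcard] at h
  have e4 : (49 * kahaneKhintchineConst.{u} q 2 * typeConst E p) ^ q =
      2 ^ q * (49 / 2 * kahaneKhintchineConst.{u} q 2 * typeConst E p) ^ q := by
    rw [← Real.mul_rpow (by norm_num) (by positivity)]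
    congr 1; ring
  rw [← Finset.mul_sum, e4]
  exact (mul_le_mul_of_nonneg_left h (by positivity)).trans_eq (by ring)

theorem continuous_diffWeight (k : ℕ) : Continuous fun z : ℝ × ℝ => diffWeight k z.1 z.2 := by
  unfold diffWeight
  fun_prop

variable {Ω : Type v} [MeasurableSpace Ω] {P : Measure Ω} [IsProbabilityMeasure P]

/-- The Monte Carlo error bound for independent copies on a product space. -/
theorem eLpNorm_pi_center_le {p q : ℝ} (hE : HasRademacherType E p) (hpq : p ≤ q)
    {k : ℕ} (hk : k ≠ 0) (n : ℕ) {X Y : Ω → E} (hX : StronglyMeasurable X)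
    (hY : StronglyMeasurable Y)
    (hint : Integrable (fun ω => tensorPow k (X ω) - tensorPow k (Y ω)) P) :
    eLpNorm (fun w : Fin n → Ω => ∑ j, (tensorPow k (X (w j)) - tensorPow k (Y (w j)) -
        ∫ ω, (tensorPow k (X ω) - tensorPow k (Y ω)) ∂P)) (ENNReal.ofReal q)
        (Measure.pi fun _ => P) ≤
      ENNReal.ofReal (49 * kahaneKhintchineConst.{u} q 2 * typeConst E p * (n : ℝ) ^ (1 / p)) *
        eLpNorm (fun ω => diffWeight k ‖X ω - Y ω‖ ‖Y ω‖) (ENNReal.ofReal q) P := by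
  have hp : 0 < p := by linarith [hE.1.1]
  have hq : 0 < q := hp.trans_le hpq
  have hq1 : 1 ≤ q := hE.1.1.trans hpq
  have hK : 0 ≤ kahaneKhintchineConst.{u} q 2 :=
    zero_le_one.trans (one_le_kahaneKhintchineConst one_le_two hq)
  have hτ := typeConst_nonneg E p
  have hζ : StronglyMeasurable fun ω => tensorPow k (X ω) - tensorPow k (Y ω) :=
    ((continuous_tensorPow k).comp_stronglyMeasurable hX).sub
      ((continuous_tensorPow k).comp_stronglyMeasurable hY)
  have hWm : StronglyMeasurable fun ω => diffWeight k ‖X ω - Y ω‖ ‖Y ω‖ :=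
    (continuous_diffWeight k).comp_stronglyMeasurable ((hX.sub hY).norm.prodMk hY.norm)
  rw [eLpNorm_eq_lintegral_rpow_enorm_toReal (by simpa using hq) (by simp),
    eLpNorm_eq_lintegral_rpow_enorm_toReal (by simpa using hq) (by simp),
    ENNReal.toReal_ofReal hq.le]
  set c := 49 * kahaneKhintchineConst.{u} q 2 * typeConst E p with hc
  have hc0 : 0 ≤ c := by positivity
  set I := ∫⁻ w : Fin n → Ω, ‖∑ j, (tensorPow k (X (w j)) - tensorPow k (Y (w j)) -
        ∫ ω, (tensorPow k (X ω) - tensorPow k (Y ω)) ∂P)‖ₑ ^ q ∂(Measure.pi fun _ => P)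
  set J := ∫⁻ ω, ‖diffWeight k ‖X ω - Y ω‖ ‖Y ω‖‖ₑ ^ q ∂P
  have hWj : ∀ j : Fin n, ∫⁻ w : Fin n → Ω,
      ‖diffWeight k ‖X (w j) - Y (w j)‖ ‖Y (w j)‖‖ₑ ^ q ∂(Measure.pi fun _ => P) = J := fun j =>
    (measurePreserving_eval (fun _ : Fin n => P) j).lintegral_comp (hWm.enorm.pow_const q)
  have hWjm : ∀ j : Fin n, Measurable fun w : Fin n → Ω =>
      ‖diffWeight k ‖X (w j) - Y (w j)‖ ‖Y (w j)‖‖ₑ ^ q := fun j =>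
    (hWm.enorm.pow_const q).comp (measurable_pi_apply j)
  have hsig : ∀ ε : Fin n → ℤˣ, StronglyMeasurable fun w : Fin n → Ω =>
      (2 : ℝ) • signSum (fun j => tensorPow k (X (w j)) - tensorPow k (Y (w j))) ε := fun ε =>
    stronglyMeasurable_smul_signSum hζ ε
  have hbound : 2 ^ n * I ≤ 2 ^ n * (ENNReal.ofReal (c ^ q * (n : ℝ) ^ (q / p - 1)) * (n * J)) := by
    have h := lintegral_pi_center_le hζ hint hq1 n 0
    simp only [zero_add] at h
    refine h.trans ?_
    rw [← lintegral_finsetSum _ fun ε _ => ?_]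
    · refine (lintegral_mono fun w => sum_enorm_signSum_tensorPow_rpow_le hE hpq hk _ _).trans_eq ?_
      rw [lintegral_const_mul' _ _ (by simp), lintegral_const_mul' _ _ (by simp),
        lintegral_finsetSum _ fun j _ => hWjm j]
      simp [hWj, hc]
    · exact (hsig ε).enorm.pow_const _
  have hI : I ≤ ENNReal.ofReal (c * (n : ℝ) ^ (1 / p)) ^ q * J := by
    refine ((ENNReal.mul_le_mul_iff_right (by simp) (by simp)).1 hbound).trans_eq ?_
    rw [← mul_assoc, ENNReal.ofReal_rpow_of_nonneg (by positivity) hq.le,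
      ← ENNReal.ofReal_natCast n, ← ENNReal.ofReal_mul (by positivity)]
    congr 2
    rw [Real.mul_rpow hc0 (by positivity), ← Real.rpow_mul (by positivity), mul_assoc,
      one_div_mul_eq_div]
    congr 1
    -- The identity `n^(q/p - 1) · n = n^(q/p)` needs a separate look at `n = 0`, where both sides
    -- vanish.
    rcases Nat.eq_zero_or_pos n with rfl | hn
    · rw [Nat.cast_zero, mul_zero, Real.zero_rpow (by positivity)]
    · rw [Real.rpow_sub_one (by positivity)]
      field_simp
  calc I ^ (1 / q) ≤ (ENNReal.ofReal (c * (n : ℝ) ^ (1 / p)) ^ q * J) ^ (1 / q) :=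
        ENNReal.rpow_le_rpow hI (by positivity)
    _ = _ := by
        rw [ENNReal.mul_rpow_of_nonneg _ _ (by positivity), ← ENNReal.rpow_mul,
          mul_one_div_cancel hq.ne', ENNReal.rpow_one]

/-- Sums of independent copies of `ζ` are distributed as on the product space. -/
theorem identDistrib_sum_pi {F : Type*} [NormedAddCommGroup F] [MeasurableSpace F] [BorelSpace F]
    {n : ℕ} {ξ : Fin n → Ω → F} {ζ : Ω → F} (hζ : AEStronglyMeasurable ζ P)
    (hindep : iIndepFun ξ P) (hcopy : ∀ j, IdentDistrib (ξ j) ζ P P) (m : F) :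
    IdentDistrib (fun ω => ∑ j, (ξ j ω - m)) (fun w : Fin n → Ω => ∑ j, (ζ (w j) - m)) P
      (Measure.pi fun _ => P) := by
  -- The given copies share the law of the tensor difference but come with no underlying pairs `(X,
  -- Y)`. On the product space, `ζ (w j)` is built from such pairs, which is why the law is
  -- transferred there.
  have hζm := hζ.aemeasurable
  have hν : IsProbabilityMeasure (P.map ζ) := Measure.isProbabilityMeasure_map hζm
  -- `F` need not be separable, so addition may fail to be measurable for the product σ-algebra.
  -- Almost everywhere strong measurability of the identity under the law of `ζ` is the substitute.
  have hid : AEStronglyMeasurable (id : F → F) (P.map ζ) :=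
    IdentDistrib.aestronglyMeasurable_snd (f := ζ) (μ := P)
      ⟨hζm, aemeasurable_id, by simp⟩ hζ
  have hjoint : IdentDistrib (fun ω j => ξ j ω) (fun (w : Fin n → Ω) j => ζ (w j)) P
      (Measure.pi fun _ => P) := by
    refine ⟨aemeasurable_pi_iff.2 fun j => (hcopy j).aemeasurable_fst,
      aemeasurable_pi_iff.2 fun j => hζm.comp_quasiMeasurePreserving
        (Measure.quasiMeasurePreserving_eval (μ := fun _ : Fin n => P) j), ?_⟩
    rw [(iIndepFun_iff_map_fun_eq_pi_map fun j => (hcopy j).aemeasurable_fst).1 hindep,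
      Measure.pi_map_pi fun _ => hζm]
    simp only [(hcopy _).map_eq]
  have hu : AEStronglyMeasurable (fun v : Fin n → F => ∑ j, (v j - m))
      (Measure.pi fun _ => P.map ζ) :=
    Finset.aestronglyMeasurable_fun_sum _ fun j _ =>
      (hid.comp_quasiMeasurePreserving
        (Measure.quasiMeasurePreserving_eval (μ := fun _ : Fin n => P.map ζ) j)).sub
        aestronglyMeasurable_const
  refine hjoint.comp_of_aemeasurable (u := fun v : Fin n → F => ∑ j, (v j - m)) ?_
  rw [(iIndepFun_iff_map_fun_eq_pi_map fun j => (hcopy j).aemeasurable_fst).1 hindep]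
  simp only [(hcopy _).map_eq]
  exact hu.aemeasurable

end LevelEstimate

/-! ### Hölder bounds, the constant, and summation over levels. -/

section MainTheorem

variable {E : Type u} [NormedAddCommGroup E] {Ω : Type v} [MeasurableSpace Ω] {P : Measure Ω}

/-- Hölder's inequality for a product of powers of norms. -/
theorem eLpNorm_norm_pow_mul_norm_pow_le {X Y : Ω → E} (hX : AEStronglyMeasurable X P)
    (hY : AEStronglyMeasurable Y P) {q : ℝ} (hq : 0 < q) {i l : ℕ} (hil : i + l ≠ 0) :
    eLpNorm (fun ω => ‖X ω‖ ^ i * ‖Y ω‖ ^ l) (ENNReal.ofReal q) P ≤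
      eLpNorm X (ENNReal.ofReal ((i + l : ℕ) * q)) P ^ i *
        eLpNorm Y (ENNReal.ofReal ((i + l : ℕ) * q)) P ^ l := by
  set k : ℝ := ((i + l : ℕ) : ℝ) with hk
  have hk0 : 0 < k := by rw [hk]; positivity
  have hkq : 0 < k * q := by positivity
  have hroot : ∀ (Z : Ω → E) (m : ℕ), eLpNorm Z (ENNReal.ofReal (k * q)) P ^ m =
      ((∫⁻ ω, ‖Z ω‖ₑ ^ (k * q) ∂P) ^ ((m : ℝ) / k)) ^ (1 / q) := fun Z m => by
    rw [eLpNorm_eq_lintegral_rpow_enorm_toReal (by simpa using hkq) (by simp),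
      ENNReal.toReal_ofReal hkq.le, ← ENNReal.rpow_mul, ← ENNReal.rpow_natCast,
      ← ENNReal.rpow_mul]
    congr 1
    field_simp
  have hpt : ∀ ω, ‖‖X ω‖ ^ i * ‖Y ω‖ ^ l‖ₑ ^ q =
      (‖X ω‖ₑ ^ (k * q)) ^ ((i : ℝ) / k) * (‖Y ω‖ₑ ^ (k * q)) ^ ((l : ℝ) / k) := fun ω => by
    have e : ∀ m : ℕ, k * q * (m / k) = m * q := fun m => by field_simp
    rw [enorm_mul, enorm_pow, enorm_pow, enorm_norm, enorm_norm,
      ENNReal.mul_rpow_of_nonneg _ _ hq.le, ← ENNReal.rpow_mul, ← ENNReal.rpow_mul, e, e,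
      ENNReal.rpow_mul, ENNReal.rpow_mul, ENNReal.rpow_natCast, ENNReal.rpow_natCast]
  rw [hroot, hroot, ← ENNReal.mul_rpow_of_nonneg _ _ (by positivity),
    eLpNorm_eq_lintegral_rpow_enorm_toReal (by simpa using hq) (by simp),
    ENNReal.toReal_ofReal hq.le]
  simp only [hpt]
  refine ENNReal.rpow_le_rpow (ENNReal.lintegral_mul_norm_pow_le (hX.enorm.pow_const _)
    (hY.enorm.pow_const _) (by positivity) (by positivity) ?_) (by positivity)
  rw [← add_div, hk]
  push_cast
  exact div_self (by rw [hk] at hk0; push_cast at hk0; exact hk0.ne')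

theorem memLp_tensorPow [NormedSpace ℝ E] {X : Ω → E} {q : ℝ} (hq : 0 < q) {k : ℕ} (hk : k ≠ 0)
    (hX : MemLp X (ENNReal.ofReal (k * q)) P) :
    MemLp (fun ω => tensorPow k (X ω)) (ENNReal.ofReal q) P := by
  have h := eLpNorm_norm_pow_mul_norm_pow_le hX.aestronglyMeasurable hX.aestronglyMeasurable hq
    (i := k) (l := 0) hk
  refine ⟨(continuous_tensorPow k).comp_aestronglyMeasurable hX.aestronglyMeasurable, ?_⟩
  refine ((eLpNorm_mono_real fun ω => ?_).trans h).trans_lt ?_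
  · simpa using norm_tensorPow_le hk (X ω)
  · simpa using ENNReal.pow_lt_top hX.eLpNorm_lt_top

theorem lrNorm_nonneg {F : Type*} [NormedAddCommGroup F] (r : ℝ) (f : Ω → F) :
    0 ≤ lrNorm r f P :=
  ENNReal.toReal_nonneg

theorem lrNorm_sum_le {F ι : Type*} [NormedAddCommGroup F] {r : ℝ} (hr : 1 ≤ r) (s : Finset ι)
    {f : ι → Ω → F} (hf : ∀ i ∈ s, MemLp (f i) (ENNReal.ofReal r) P) :
    lrNorm r (fun ω => ∑ i ∈ s, f i ω) P ≤ ∑ i ∈ s, lrNorm r (f i) P := by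
  have h := eLpNorm_sum_le (fun i hi => (hf i hi).aestronglyMeasurable)
    (ENNReal.one_le_ofReal.2 hr)
  rw [lrNorm, Finset.sum_fn] at *
  refine (ENNReal.toReal_mono (ENNReal.sum_ne_top.2 fun i hi => (hf i hi).eLpNorm_ne_top)
    h).trans_eq (ENNReal.toReal_sum fun i hi => (hf i hi).eLpNorm_ne_top)

theorem lrNorm_const_smul {F : Type*} [NormedAddCommGroup F] [NormedSpace ℝ F] (r c : ℝ)
    (f : Ω → F) : lrNorm r (fun ω => c • f ω) P = |c| * lrNorm r f P := by
  have h := eLpNorm_const_smul c f (ENNReal.ofReal r) P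
  change (eLpNorm (c • f) (ENNReal.ofReal r) P).toReal = _
  rw [h, ENNReal.toReal_mul, lrNorm]
  simp

/-- The `L_q`-norm of the weight is bounded by the `L_{kq}`-norms of its arguments. -/
theorem lrNorm_diffWeight_le {q : ℝ} (hq : 1 ≤ q) {k : ℕ} {D Y : Ω → E}
    (hD : MemLp D (ENNReal.ofReal (k * q)) P) (hY : MemLp Y (ENNReal.ofReal (k * q)) P) :
    MemLp (fun ω => diffWeight k ‖D ω‖ ‖Y ω‖) (ENNReal.ofReal q) P ∧
    lrNorm q (fun ω => diffWeight k ‖D ω‖ ‖Y ω‖) P ≤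
      k * ∑ i ∈ Finset.range k, (k.choose (i + 1) : ℝ) *
        (lrNorm (k * q) D P ^ (i + 1) * lrNorm (k * q) Y P ^ (k - 1 - i)) := by
  have hq0 : 0 < q := by linarith
  have hterm : ∀ i ∈ Finset.range k,
      eLpNorm (fun ω => ‖D ω‖ ^ (i + 1) * ‖Y ω‖ ^ (k - 1 - i)) (ENNReal.ofReal q) P ≤
      eLpNorm D (ENNReal.ofReal (k * q)) P ^ (i + 1) *
        eLpNorm Y (ENNReal.ofReal (k * q)) P ^ (k - 1 - i) := fun i hi => by
    have e : i + 1 + (k - 1 - i) = k := by have := Finset.mem_range.1 hi; omega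
    have h := eLpNorm_norm_pow_mul_norm_pow_le hD.aestronglyMeasurable hY.aestronglyMeasurable hq0
      (i := i + 1) (l := k - 1 - i) (by omega)
    rwa [e] at h
  have hfin : ∀ i, eLpNorm D (ENNReal.ofReal (k * q)) P ^ (i + 1) *
      eLpNorm Y (ENNReal.ofReal (k * q)) P ^ (k - 1 - i) < ∞ := fun i =>
    ENNReal.mul_lt_top (ENNReal.pow_lt_top hD.eLpNorm_lt_top)
      (ENNReal.pow_lt_top hY.eLpNorm_lt_top)
  have hmem : ∀ i ∈ Finset.range k,
      MemLp (fun ω => ‖D ω‖ ^ (i + 1) * ‖Y ω‖ ^ (k - 1 - i)) (ENNReal.ofReal q) P := fun i hi =>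
    ⟨(hD.aestronglyMeasurable.norm.pow _).mul (hY.aestronglyMeasurable.norm.pow _),
      (hterm i hi).trans_lt (hfin i)⟩
  have hmem' : ∀ i ∈ Finset.range k, MemLp (fun ω => (k.choose (i + 1) : ℝ) •
      (‖D ω‖ ^ (i + 1) * ‖Y ω‖ ^ (k - 1 - i))) (ENNReal.ofReal q) P := fun i hi =>
    (hmem i hi).const_smul (k.choose (i + 1) : ℝ)
  have e : (fun ω => diffWeight k ‖D ω‖ ‖Y ω‖) = fun ω => (k : ℝ) •
      ∑ i ∈ Finset.range k, (k.choose (i + 1) : ℝ) • (‖D ω‖ ^ (i + 1) * ‖Y ω‖ ^ (k - 1 - i)) := by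
    ext ω
    rw [diffWeight_eq_sum]
    rfl
  rw [e]
  refine ⟨(memLp_finsetSum _ hmem').const_smul (k : ℝ), ?_⟩
  rw [lrNorm_const_smul, Nat.abs_cast]
  refine mul_le_mul_of_nonneg_left ((lrNorm_sum_le hq _ hmem').trans
    (Finset.sum_le_sum fun i hi => ?_)) (Nat.cast_nonneg k)
  rw [lrNorm_const_smul, Nat.abs_cast]
  refine mul_le_mul_of_nonneg_left ?_ (Nat.cast_nonneg _)
  refine (ENNReal.toReal_mono (hfin i).ne (hterm i hi)).trans_eq ?_
  simp [lrNorm]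

variable [NormedSpace ℝ E] [IsProbabilityMeasure P]

/-- `2 · 16 √π > 49` because `(49/32)² < 3 < π`, and `K_{q,p} ≥ 1`; the maximum with `B_q` only
enlarges the right side. -/
theorem mul_typeConst_le_mlConst {p q : ℝ} (hE : HasRademacherType E p) (hpq : p ≤ q) (k : ℕ) :
    49 * kahaneKhintchineConst.{u} q 2 * typeConst E p * k ≤ mlConst E q p k := by
  have hq : 0 < q := by linarith [hE.1.1]
  have h1 := one_le_kahaneKhintchineConst.{u} hE.1.1 hq
  have h2 := one_le_kahaneKhintchineConst.{u} one_le_two hq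
  have hτ := typeConst_nonneg E p
  have hπ : (49 / 32 : ℝ) ≤ √Real.pi := by
    refine Real.le_sqrt_of_sq_le ?_
    nlinarith [Real.pi_gt_three]
  have h3 : (49 : ℝ) ≤ 32 * (√Real.pi * kahaneKhintchineConst.{u} q p) := by nlinarith
  have h4 : diffConst E q p k ≤ max (diffConst E q p k) (khintchineConst q) := le_max_left _ _
  have h5 : 0 ≤ kahaneKhintchineConst.{u} q 2 * typeConst E p * k := by positivity
  have h6 := mul_le_mul_of_nonneg_right h3 h5
  rw [mlConst]
  refine le_trans ?_ (mul_le_mul_of_nonneg_left h4 two_pos.le)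
  rw [diffConst]
  linarith

/-- The Monte Carlo error bound on a single level. -/
theorem lrNorm_level_le {p q : ℝ} (hE : HasRademacherType E p) (hpq : p ≤ q) {k : ℕ}
    (hk : k ≠ 0) {n : ℕ} (hn : n ≠ 0) {X Y : Ω → E}
    (hX : MemLp X (ENNReal.ofReal (k * q)) P) (hY : MemLp Y (ENNReal.ofReal (k * q)) P)
    {ξ : Fin n → Ω → SymInjTensor E k} (hindep : iIndepFun ξ P)
    (hcopy : ∀ j, IdentDistrib (ξ j) (fun ω => tensorPow k (X ω) - tensorPow k (Y ω)) P P)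
    {c : ℕ → ℝ} (hc : ∀ i, 0 ≤ c i) :
    lrNorm q (fun ω => ∫ ω', (tensorPow k (X ω') - tensorPow k (Y ω')) ∂P -
        (n : ℝ)⁻¹ • ∑ j, ξ j ω) P ≤
      mlConst E q p k * ((n : ℝ) ^ (-(1 - 1 / p)) * lrNorm (k * q) (fun ω => X ω - Y ω) P *
        ∑ i ∈ Finset.range k,
          ((k.choose (i + 1) : ℝ) * lrNorm (k * q) (fun ω => X ω - Y ω) P ^ i + c i) *
            lrNorm (k * q) Y P ^ (k - i - 1)) := by
  have hq1 : 1 ≤ q := hE.1.1.trans hpq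
  have hq : 0 < q := by linarith
  have hK : 0 ≤ kahaneKhintchineConst.{u} q 2 :=
    zero_le_one.trans (one_le_kahaneKhintchineConst one_le_two hq)
  have hτ := typeConst_nonneg E p
  -- The product-space estimate needs strongly measurable representatives.
  obtain ⟨X', hX', hXX'⟩ := hX.aestronglyMeasurable
  obtain ⟨Y', hY', hYY'⟩ := hY.aestronglyMeasurable
  have hζ : MemLp (fun ω => tensorPow k (X ω) - tensorPow k (Y ω)) (ENNReal.ofReal q) P :=
    (memLp_tensorPow hq hk hX).sub (memLp_tensorPow hq hk hY)
  have hae : (fun ω => tensorPow k (X ω) - tensorPow k (Y ω)) =ᵐ[P]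
      fun ω => tensorPow k (X' ω) - tensorPow k (Y' ω) := by
    filter_upwards [hXX', hYY'] with ω h1 h2
    rw [h1, h2]
  have hae' : (fun ω => diffWeight k ‖X' ω - Y' ω‖ ‖Y' ω‖) =ᵐ[P]
      fun ω => diffWeight k ‖X ω - Y ω‖ ‖Y ω‖ := by
    filter_upwards [hXX', hYY'] with ω h1 h2
    rw [h1, h2]
  have hζ' := hζ.ae_eq hae
  have hint := hζ'.integrable (ENNReal.one_le_ofReal.2 hq1)
  have hcopy' : ∀ j, IdentDistrib (ξ j) (fun ω => tensorPow k (X' ω) - tensorPow k (Y' ω)) P P :=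
    fun j => (hcopy j).trans (IdentDistrib.of_ae_eq hζ.aestronglyMeasurable.aemeasurable hae)
  rw [integral_congr_ae hae]
  set m := ∫ ω, (tensorPow k (X' ω) - tensorPow k (Y' ω)) ∂P with hm
  obtain ⟨hWmem, hW⟩ := lrNorm_diffWeight_le hq1 (hX.sub hY) hY
  have hsum : lrNorm q (fun ω => ∑ j, (ξ j ω - m)) P ≤
      49 * kahaneKhintchineConst.{u} q 2 * typeConst E p * (n : ℝ) ^ (1 / p) *
        lrNorm q (fun ω => diffWeight k ‖X ω - Y ω‖ ‖Y ω‖) P := by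
    have h := eLpNorm_pi_center_le hE hpq hk n hX' hY' hint
    rw [← hm, ← (identDistrib_sum_pi hζ'.aestronglyMeasurable hindep hcopy' m).eLpNorm_eq,
      eLpNorm_congr_ae hae'] at h
    refine (ENNReal.toReal_mono (ENNReal.mul_ne_top ENNReal.ofReal_ne_top
      hWmem.eLpNorm_ne_top) h).trans_eq ?_
    rw [ENNReal.toReal_mul, ENNReal.toReal_ofReal (by positivity)]
    rfl
  have e1 : (fun ω => m - (n : ℝ)⁻¹ • ∑ j, ξ j ω) =
      fun ω => (-(n : ℝ)⁻¹) • ∑ j, (ξ j ω - m) := by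
    ext ω
    rw [Finset.sum_sub_distrib, Finset.sum_const, Finset.card_univ, Fintype.card_fin,
      ← Nat.cast_smul_eq_nsmul ℝ, neg_smul, smul_sub, smul_smul,
      inv_mul_cancel₀ (Nat.cast_ne_zero.2 hn), one_smul, neg_sub]
  rw [e1, lrNorm_const_smul, abs_neg, abs_of_nonneg (by positivity)]
  have hD := lrNorm_nonneg (P := P) (k * q) (fun ω => X ω - Y ω)
  have hYn := lrNorm_nonneg (P := P) (k * q) Y
  change lrNorm q (fun ω => diffWeight k ‖X ω - Y ω‖ ‖Y ω‖) P ≤ k * ∑ i ∈ Finset.range k,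
    (k.choose (i + 1) : ℝ) * (lrNorm (k * q) (fun ω => X ω - Y ω) P ^ (i + 1) *
      lrNorm (k * q) Y P ^ (k - 1 - i)) at hW
  set d := lrNorm (k * q) (fun ω => X ω - Y ω) P
  set y := lrNorm (k * q) Y P
  -- The binomial terms alone bound the error; the nonnegative `c i` are added to match the stated
  -- form.
  have hW2 : ∑ i ∈ Finset.range k, (k.choose (i + 1) : ℝ) * (d ^ (i + 1) * y ^ (k - 1 - i)) ≤
      d * ∑ i ∈ Finset.range k, ((k.choose (i + 1) : ℝ) * d ^ i + c i) * y ^ (k - i - 1) := by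
    rw [Finset.mul_sum]
    refine Finset.sum_le_sum fun i _ => ?_
    have h1 : 0 ≤ d * (c i * y ^ (k - i - 1)) :=
      mul_nonneg hD (mul_nonneg (hc i) (by positivity))
    rw [Nat.sub_right_comm]
    calc _ ≤ (k.choose (i + 1) : ℝ) * (d ^ (i + 1) * y ^ (k - i - 1)) +
          d * (c i * y ^ (k - i - 1)) := le_add_of_nonneg_right h1
      _ = _ := by ring
  have hn0 : (0 : ℝ) < n := by positivity
  have e2 : (n : ℝ)⁻¹ * (n : ℝ) ^ (1 / p) = (n : ℝ) ^ (-(1 - 1 / p)) := by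
    rw [neg_sub, Real.rpow_sub_one hn0.ne', inv_mul_eq_div]
  have hconst := mul_typeConst_le_mlConst hE hpq k
  set R := ∑ i ∈ Finset.range k, ((k.choose (i + 1) : ℝ) * d ^ i + c i) * y ^ (k - i - 1)
  have hR : 0 ≤ R := Finset.sum_nonneg fun i _ =>
    mul_nonneg (add_nonneg (by positivity) (hc i)) (by positivity)
  calc (n : ℝ)⁻¹ * lrNorm q (fun ω => ∑ j, (ξ j ω - m)) P
      ≤ (n : ℝ)⁻¹ * (49 * kahaneKhintchineConst.{u} q 2 * typeConst E p * (n : ℝ) ^ (1 / p) *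
        (k * (d * R))) := by
        refine mul_le_mul_of_nonneg_left (hsum.trans ?_) (by positivity)
        exact mul_le_mul_of_nonneg_left (hW.trans
          (mul_le_mul_of_nonneg_left hW2 (Nat.cast_nonneg k))) (by positivity)
    _ = (49 * kahaneKhintchineConst.{u} q 2 * typeConst E p * k) *
        (((n : ℝ)⁻¹ * (n : ℝ) ^ (1 / p)) * d * R) := by ring
    _ ≤ _ := by
        rw [e2]
        exact mul_le_mul_of_nonneg_right hconst (by positivity)

end MainTheorem

theorem mainTheorem2
    {E : Type u} [NormedAddCommGroup E] [NormedSpace ℝ E] [CompleteSpace E]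
    {Ω : Type v} [MeasurableSpace Ω] (P : Measure Ω) [IsProbabilityMeasure P]
    (p q : ℝ) (k L : ℕ) (hE : HasRademacherType E p) (hpq : p ≤ q) (hk : 1 ≤ k) (hL : 1 ≤ L)
    (X : ℕ → Ω → E) (hX0 : ∀ ω, X 0 ω = 0)
    (hX : ∀ ℓ ∈ Finset.Icc 1 L, MemLp (X ℓ) (ENNReal.ofReal (k * q)) P)
    (M : ℕ → ℕ) (hM : ∀ ℓ ∈ Finset.Icc 1 L, 1 ≤ M ℓ)
    (ξ : (ℓ : ℕ) → Fin (M ℓ) → Ω → SymInjTensor E k)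
    (hindep : ∀ ℓ ∈ Finset.Icc 1 L, iIndepFun (ξ ℓ) P)
    (hcopy : ∀ ℓ ∈ Finset.Icc 1 L, ∀ j : Fin (M ℓ),
      IdentDistrib (ξ ℓ j)
        (fun ω => tensorPow k (X ℓ ω) - tensorPow k (X (ℓ - 1) ω)) P P) :
    (∀ ℓ ∈ Finset.Icc 1 L,
      MemLp (fun ω => tensorPow k (X ℓ ω) - tensorPow k (X (ℓ - 1) ω)) (ENNReal.ofReal q) P) ∧
    Integrable (fun ω => tensorPow k (X L ω)) P ∧
    ∀ U : SymInjTensor E k,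
      MemLp (fun ω => U - ∑ ℓ ∈ Finset.Icc 1 L, (M ℓ : ℝ)⁻¹ • ∑ j : Fin (M ℓ), ξ ℓ j ω)
        (ENNReal.ofReal q) P ∧
      lrNorm q (fun ω => U - ∑ ℓ ∈ Finset.Icc 1 L, (M ℓ : ℝ)⁻¹ • ∑ j : Fin (M ℓ), ξ ℓ j ω) P ≤
        ‖U - injMoment k (X L) P‖ +
        mlConst E q p k * ∑ ℓ ∈ Finset.Icc 1 L,
          ((M ℓ : ℝ) ^ (-(1 - 1 / p)) *
            lrNorm (k * q) (fun ω => X ℓ ω - X (ℓ - 1) ω) P *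
            ∑ i ∈ Finset.range k,
              ((k.choose (i + 1) : ℝ) * lrNorm (k * q) (fun ω => X ℓ ω - X (ℓ - 1) ω) P ^ i +
                  lrNorm k (X ℓ) P ^ i) *
                lrNorm (k * q) (X (ℓ - 1)) P ^ (k - i - 1)) := by
  have hq1 : 1 ≤ q := hE.1.1.trans hpq
  have hq : 0 < q := by linarith
  have hk0 : k ≠ 0 := by omega
  have hXmem : ∀ ℓ ≤ L, MemLp (X ℓ) (ENNReal.ofReal (k * q)) P := fun ℓ hℓ => by
    rcases Nat.eq_zero_or_pos ℓ with rfl | h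
    · rw [show X 0 = fun _ => 0 from funext hX0]
      exact MemLp.zero'
    · exact hX ℓ (Finset.mem_Icc.2 ⟨h, hℓ⟩)
  have hT : ∀ ℓ ≤ L, MemLp (fun ω => tensorPow k (X ℓ ω)) (ENNReal.ofReal q) P := fun ℓ hℓ =>
    memLp_tensorPow hq hk0 (hXmem ℓ hℓ)
  have hTint : ∀ ℓ ≤ L, Integrable (fun ω => tensorPow k (X ℓ ω)) P := fun ℓ hℓ =>
    (hT ℓ hℓ).integrable (ENNReal.one_le_ofReal.2 hq1)
  have hdiff : ∀ ℓ ∈ Finset.Icc 1 L,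
      MemLp (fun ω => tensorPow k (X ℓ ω) - tensorPow k (X (ℓ - 1) ω)) (ENNReal.ofReal q) P :=
    fun ℓ hℓ => by
      have := Finset.mem_Icc.1 hℓ
      exact (hT ℓ this.2).sub (hT (ℓ - 1) (by omega))
  refine ⟨hdiff, hTint L le_rfl, fun U => ?_⟩
  let m : ℕ → SymInjTensor E k := fun ℓ =>
    ∫ ω, (tensorPow k (X ℓ ω) - tensorPow k (X (ℓ - 1) ω)) ∂P
  let Z : ℕ → Ω → SymInjTensor E k := fun ℓ ω => m ℓ - (M ℓ : ℝ)⁻¹ • ∑ j : Fin (M ℓ), ξ ℓ j ω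
  have hZ : ∀ ℓ ∈ Finset.Icc 1 L, MemLp (Z ℓ) (ENNReal.ofReal q) P := fun ℓ hℓ =>
    (memLp_const _).sub ((memLp_finsetSum _ fun j _ =>
      (hcopy ℓ hℓ j).symm.memLp_snd (hdiff ℓ hℓ)).const_smul (M ℓ : ℝ)⁻¹)
  have hm : ∑ ℓ ∈ Finset.Icc 1 L, m ℓ = injMoment k (X L) P := by
    -- The base case is `⊗ᵏ 0 = 0`, which needs `k ≠ 0`.
    have hmL : ∀ l ≤ L, ∑ ℓ ∈ Finset.Icc 1 l, m ℓ = injMoment k (X l) P := fun l => by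
      induction l with
      | zero => simp [injMoment, hX0, tensorPow_zero hk0]
      | succ l ih =>
        intro hl
        rw [Finset.sum_Icc_succ_top (by omega), ih (by omega)]
        simp only [m, injMoment, Nat.add_sub_cancel]
        rw [integral_sub (hTint _ hl) (hTint _ (by omega))]
        abel
    exact hmL L le_rfl
  have e : (fun ω => U - ∑ ℓ ∈ Finset.Icc 1 L, (M ℓ : ℝ)⁻¹ • ∑ j : Fin (M ℓ), ξ ℓ j ω) =
      (fun _ => U - injMoment k (X L) P) + fun ω => ∑ ℓ ∈ Finset.Icc 1 L, Z ℓ ω := by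
    ext ω
    simp only [Z, Pi.add_apply, Finset.sum_sub_distrib, hm]
    abel
  have hsum : MemLp (fun ω => ∑ ℓ ∈ Finset.Icc 1 L, Z ℓ ω) (ENNReal.ofReal q) P :=
    memLp_finsetSum _ hZ
  have hconst : MemLp (fun _ : Ω => U - injMoment k (X L) P) (ENNReal.ofReal q) P :=
    memLp_const _
  rw [e]
  refine ⟨hconst.add hsum, ?_⟩
  have h1 := ENNReal.toReal_mono (ENNReal.add_ne_top.2 ⟨hconst.eLpNorm_ne_top,
    hsum.eLpNorm_ne_top⟩) (eLpNorm_add_le hconst.aestronglyMeasurable hsum.aestronglyMeasurable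
      (ENNReal.one_le_ofReal.2 hq1))
  rw [ENNReal.toReal_add hconst.eLpNorm_ne_top hsum.eLpNorm_ne_top,
    eLpNorm_const _ (by simpa using hq) (NeZero.ne P)] at h1
  simp only [measure_univ, ENNReal.one_rpow, mul_one, toReal_enorm] at h1
  refine h1.trans (add_le_add le_rfl ((lrNorm_sum_le hq1 _ hZ).trans ?_))
  rw [Finset.mul_sum]
  refine Finset.sum_le_sum fun ℓ hℓ => ?_
  have hℓ' := Finset.mem_Icc.1 hℓ
  -- The free sequence `c i` is taken to be `‖X_ℓ‖^i` in the `L_k`-norm.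
  exact lrNorm_level_le hE hpq hk0 (Nat.one_le_iff_ne_zero.1 (hM ℓ hℓ)) (hXmem ℓ hℓ'.2)
    (hXmem (ℓ - 1) (by omega)) (hindep ℓ hℓ) (hcopy ℓ hℓ)
    fun i => pow_nonneg (lrNorm_nonneg _ _) i
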